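/- **Theorem.** There is a deterministic single-pass semi-streaming algorithm that, for every finite ground set $\mathcal N$, every non-negative (not necessarily monotone) submodular function $f\colon 2^{\mathcal N}\to\mathbb R_{\ge 0}$ and every matroid $M=(\mathcal N,\mathcal I)$ of rank $k$, outputs a set $R\in\mathcal I$ with $$f(R)\ \ge\ 0.1921\cdot \max_{S\in\mathcal I} f(S),$$ while storing $O(k)$ elements and using $\widetilde O(k)$ additional memory at all times. Here the algorithm is given $k$; the elements of $\mathcal N$ arrive one by one in an arbitrary (adversarial) order, each exactly once, and the size of $\mathcal N$ is not known in advance. The algorithm is a fixed finite program, with loops, indirect addressing, exact integer and real arithmetic and comparisons. It accesses $f$ and $M$ only through a value oracle and an independence oracle, which may be called on sets of elements that are currently stored in memory, and it terminates on every input. Precisely, there is a constant $C$, independent of $\mathcal N$, $f$, $M$, $k$ and the order of the stream, such that at every moment, also during the processing of an element, at most $C(k+1)$ memory cells are used for elements (including the arriving one), and, with $B = C(k+1)\lfloor\log_2(k+2)\rfloor^{C}$, the additional memory consists of at most $B$ cells for real numbers and of at most $B$ cells for natural numbers, the latter with at most $B$ bits in total. The output $R$ is the set of elements in memory when the algorithm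 stops. -/

import Mathlib

/-! Submodular set functions, and a machine model for one-pass streaming algorithms that access
the objective and the matroid through oracles. -/

/-- `f : 2^N → ℝ` is submodular: `f(u ∣ T) ≤ f(u ∣ S)` whenever `S ⊆ T` and `u ∉ T`. -/
def IsSubmodular {N : Type*} [DecidableEq N] (f : Finset N → ℝ) : Prop :=
  ∀ S T : Finset N, S ⊆ T → ∀ u, u ∉ T → f (insert u T) - f T ≤ f (insert u S) - f S

namespace StreamMachine

/-- The memory of the machine. Elements of the ground set are opaque tokens: an element cell holds
one element or nothing. The additional memory has cells for natural numbers and cells for reals. -/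
structure State (N : Type*) where
  elem : ℕ → Option N
  nat : ℕ → ℕ
  real : ℕ → ℝ

/-- Expressions with values in `ℕ`; `sub` is truncated and `div`, `mod` are Euclidean. -/
inductive NatExpr where
  | const (n : ℕ)
  | load (address : NatExpr)
  | add (a b : NatExpr)
  | sub (a b : NatExpr)
  | mul (a b : NatExpr)
  | div (a b : NatExpr)
  | mod (a b : NatExpr)

/-- Expressions with values in `ℝ`. The expression `value m` is a call of the value oracle on the
set of those elements that are stored in the element cells `j` with bit `j` of `m` equal to one. -/
inductive RealExpr where
  | const (q : ℚ)
  | load (address : NatExpr)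
  | ofNat (a : NatExpr)
  | add (a b : RealExpr)
  | sub (a b : RealExpr)
  | mul (a b : RealExpr)
  | div (a b : RealExpr)
  | value (mask : NatExpr)

/-- Tests. The test `indep m` is a call of the independence oracle on the set of those elements
that are stored in the element cells `j` with bit `j` of `m` equal to one. -/
inductive Test where
  | natLe (a b : NatExpr)
  | realLe (a b : RealExpr)
  | indep (mask : NatExpr)
  | not (p : Test)
  | and (p q : Test)

/-- Programs. -/
inductive Cmd where
  | skip
  | setNat (address : NatExpr) (a : NatExpr)
  | setReal (address : NatExpr) (a : RealExpr)
  | copyElem (target source : NatExpr)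
  | clearElem (address : NatExpr)
  | seq (p q : Cmd)
  | ite (t : Test) (p q : Cmd)
  | while (t : Test) (p : Cmd)

noncomputable section

variable {N : Type*}

namespace State

/-- The set of elements stored in the element cells that the binary number `m` points to. -/
def pick [Fintype N] (s : State N) (m : ℕ) : Finset N :=
  open Classical in Finset.univ.filter fun x => ∃ j, m.testBit j = true ∧ s.elem j = some x

/-- The set of all elements in memory. -/
def held [Fintype N] (s : State N) : Finset N :=
  open Classical in Finset.univ.filter fun x => ∃ j, s.elem j = some x

/-- The initial state: the memory is empty, except that cell `0` of the memory for natural numbers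
holds the input `k`. -/
def start (N : Type*) (k : ℕ) : State N :=
  ⟨fun _ => none, fun j => if j = 0 then k else 0, fun _ => 0⟩

/-- The next element of the stream is delivered to element cell `0`, replacing its content. -/
def receive (s : State N) (x : N) : State N :=
  { s with elem := Function.update s.elem 0 (some x) }

/-- The state uses at most `K` cells for elements, and as additional memory at most `B` cells for
reals and at most `B` cells for natural numbers, the latter with at most `B` bits in total. -/
def Fits (K B : ℕ) (s : State N) : Prop :=
  (∀ j, K ≤ j → s.elem j = none) ∧
  (∀ j, B ≤ j → s.real j = 0) ∧
  (∀ j, B ≤ j → s.nat j = 0) ∧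
  ∑ j ∈ Finset.range B, (s.nat j).size ≤ B

end State

def NatExpr.eval (s : State N) : NatExpr → ℕ
  | .const n => n
  | .load a => s.nat (a.eval s)
  | .add a b => a.eval s + b.eval s
  | .sub a b => a.eval s - b.eval s
  | .mul a b => a.eval s * b.eval s
  | .div a b => a.eval s / b.eval s
  | .mod a b => a.eval s % b.eval s

def RealExpr.eval [Fintype N] (f : Finset N → ℝ) (s : State N) : RealExpr → ℝ
  | .const q => (q : ℝ)
  | .load a => s.real (a.eval s)
  | .ofNat a => (a.eval s : ℝ)
  | .add a b => a.eval f s + b.eval f s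
  | .sub a b => a.eval f s - b.eval f s
  | .mul a b => a.eval f s * b.eval f s
  | .div a b => a.eval f s / b.eval f s
  | .value m => f (s.pick (m.eval s))

def Test.eval [Fintype N] (f : Finset N → ℝ) (M : Matroid N) (s : State N) : Test → Prop
  | .natLe a b => a.eval s ≤ b.eval s
  | .realLe a b => a.eval f s ≤ b.eval f s
  | .indep m => M.Indep (s.pick (m.eval s) : Set N)
  | .not p => ¬ p.eval f M s
  | .and p q => p.eval f M s ∧ q.eval f M s

/-- `Exec f M W p s t`: with the oracles for `f` and `M`, program `p` started in state `s` stops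
after finitely many steps in state `t`, and every state passed on the way, including `s` and `t`,
satisfies `W`. -/
inductive Exec [Fintype N] (f : Finset N → ℝ) (M : Matroid N) (W : State N → Prop) :
    Cmd → State N → State N → Prop
  | skip {s : State N} : W s → Exec f M W .skip s s
  | setNat {s : State N} {i a : NatExpr} : W s →
      W { s with nat := Function.update s.nat (i.eval s) (a.eval s) } →
      Exec f M W (.setNat i a) s { s with nat := Function.update s.nat (i.eval s) (a.eval s) }
  | setReal {s : State N} {i : NatExpr} {a : RealExpr} : W s →
      W { s with real := Function.update s.real (i.eval s) (a.eval f s) } →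
      Exec f M W (.setReal i a) s
        { s with real := Function.update s.real (i.eval s) (a.eval f s) }
  | copyElem {s : State N} {i j : NatExpr} : W s →
      W { s with elem := Function.update s.elem (i.eval s) (s.elem (j.eval s)) } →
      Exec f M W (.copyElem i j) s
        { s with elem := Function.update s.elem (i.eval s) (s.elem (j.eval s)) }
  | clearElem {s : State N} {i : NatExpr} : W s →
      W { s with elem := Function.update s.elem (i.eval s) none } →
      Exec f M W (.clearElem i) s { s with elem := Function.update s.elem (i.eval s) none }
  | seq {p q : Cmd} {s t r : State N} :
      Exec f M W p s t → Exec f M W q t r → Exec f M W (.seq p q) s r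
  | iteTrue {b : Test} {p q : Cmd} {s t : State N} :
      b.eval f M s → Exec f M W p s t → Exec f M W (.ite b p q) s t
  | iteFalse {b : Test} {p q : Cmd} {s t : State N} :
      ¬ b.eval f M s → Exec f M W q s t → Exec f M W (.ite b p q) s t
  | whileTrue {b : Test} {p : Cmd} {s t r : State N} :
      b.eval f M s → Exec f M W p s t → Exec f M W (.while b p) t r →
      Exec f M W (.while b p) s r
  | whileFalse {b : Test} {p : Cmd} {s : State N} :
      ¬ b.eval f M s → W s → Exec f M W (.while b p) s s

/-- A single pass over the stream: the elements arrive one by one, and the program `p` is run after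
each arrival. -/
def Pass [Fintype N] (f : Finset N → ℝ) (M : Matroid N) (W : State N → Prop) (p : Cmd) :
    List N → State N → State N → Prop
  | [], s, t => s = t
  | x :: l, s, t => ∃ r, Exec f M W p (s.receive x) r ∧ Pass f M W p l r t

end

/-- A single-pass streaming algorithm: a program run before the stream starts, a program run after
each arrival, and a program run after the end of the stream. -/
structure Algorithm where
  init : Cmd
  step : Cmd
  finish : Cmd

/-- On input `k`, with the oracles for `f` and `M` and the given stream, the algorithm stops, all
states it passes satisfy `W`, and the set of elements in memory at the end is `R`. -/
def Algorithm.Outputs {N : Type*} [Fintype N] (A : Algorithm) (f : Finset N → ℝ) (M : Matroid N)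
    (W : State N → Prop) (k : ℕ) (stream : List N) (R : Finset N) : Prop :=
  ∃ s₀ s₁ s₂ : State N, Exec f M W A.init (State.start N k) s₀ ∧
    Pass f M W A.step stream s₀ s₁ ∧ Exec f M W A.finish s₁ s₂ ∧ s₂.held = R

end StreamMachine

/-! The algorithm maintains `n` classes (`n = 100` at the end). Class `i` has an independent set `S
i` and the set `A i ⊇ S i` of all it ever accepted; the `A i` are disjoint. A class can take an
arriving `u` if its gain `f(u ∣ S i)` is positive and at least twice the weight of the lightest
element whose removal makes room (zero if there is room already). The able class of largest gain
takes `u`, and this gain becomes the weight `ω u`; if no class is able, `ω u = 0`.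

Submodularity gives `f ∅ + ω(S i) ≤ f (S i)` and `f (A i) ≤ f ∅ + ω(A i)`, and the factor two gives
`ω(A i) ≤ 2 ω(S i)`. In each class, an arrived `o` either has gain at most `ω o` over `A i`, or is
spanned by elements of `S i` heavier than half that gain; swaps preserve this
(`IsSwap.closure_subset`). Hall's theorem bounds the total gain of an independent set of elements of
the second kind by `2 ω(S i)` (`Matroid.Indep.sum_le_sum_of_mem_closure`).

Removed elements stay in memory until overwritten, which requires `q * ω x` to be at most the total
weight of the solutions, where `q = 10 n (k + 1)`. The weights in memory sum to at most twice that
total, so at most `2 q` elements are protected as heavy (`ExchangeInv.card_heavy_le`) and `O(k)`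
cells suffice. Let `b` be the best value of an independent set in memory, found by exhaustive search
at the end. The part of an optimum `O` in memory is worth at most `b`; the rest has weights at most
`n b / q`. Hence `f (O ∪ A i) ≤ 5.1 b` (`ExchangeInv.guarantee`). Disjointness of the `A i` replaces
monotonicity: `(n - 1) f O ≤ ∑ f (O ∪ A i)` (`IsSubmodular.sum_union_ge`). The ratio is `(1 - 1/n) /
5.1`.

In the program, element cell `0` receives arrivals, cells from `8` on store elements with their
weights in the real cells of the same address, and natural cell `16 + i` holds `S i` as a bit mask.
Correctness and the memory bound are proved together by Hoare-style rules (`Runs`, `Tame`). -/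

section

open Finset

/-! ### Inequalities for submodular functions -/

section SetFunctions

variable {N : Type*} [DecidableEq N] {f : Finset N → ℝ}

theorem IsSubmodular.insert_union_sub_le (hf : IsSubmodular f) {S T : Finset N} (h : S ⊆ T) (u : N)
    (hu : u ∈ T → u ∈ S) : f (insert u T) - f T ≤ f (insert u S) - f S := by
  by_cases huT : u ∈ T
  · simp [huT, hu huT]
  · exact hf S T h u huT

theorem IsSubmodular.union_add_inter_le (hf : IsSubmodular f) (A B : Finset N) :
    f (A ∪ B) + f (A ∩ B) ≤ f A + f B := by
  suffices h : ∀ C : Finset N, C ⊆ A → f (C ∪ B) + f (A ∩ B) ≤ f (C ∪ (A ∩ B)) + f B by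
    have := h A Subset.rfl
    rwa [union_eq_left.2 inter_subset_left] at this
  intro C
  induction C using Finset.induction_on with
  | empty => intro; simp [add_comm]
  | insert u C _ ih =>
    intro hC
    have ⟨huA, hCA⟩ := insert_subset_iff.1 hC
    have h1 := ih hCA
    have h2 := hf.insert_union_sub_le (S := C ∪ (A ∩ B)) (T := C ∪ B)
      (union_subset_union_right inter_subset_right) u (by simp +contextual [huA])
    rw [insert_union, insert_union]
    linarith

theorem IsSubmodular.union_sub_le_sum (hf : IsSubmodular f) (A O : Finset N) :
    f (O ∪ A) - f A ≤ ∑ o ∈ O, (f (insert o A) - f A) := by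
  induction O using Finset.induction_on with
  | empty => simp
  | insert u O hu ih =>
    rw [sum_insert hu, insert_union]
    by_cases huA : u ∈ A
    · simpa [huA] using ih
    · have := hf.insert_union_sub_le (S := A) (T := O ∪ A) subset_union_right u (by simp [hu])
      linarith

/-- Any two of the sets `O ∪ A i` meet exactly in `O`, so merging them one at a time releases one
copy of `f O` per merge. -/
theorem IsSubmodular.sum_union_ge (hf : IsSubmodular f) (h0 : ∀ S, 0 ≤ f S) (O : Finset N)
    (A : ℕ → Finset N) (hA : ∀ i j, i ≠ j → Disjoint (A i) (A j)) (n : ℕ) :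
    ((n : ℝ) - 1) * f O ≤ ∑ i ∈ range n, f (O ∪ A i) := by
  -- The induction carries the value of the merged set; nonnegativity discards it at the end.
  suffices h : ((n : ℝ) - 1) * f O + f (O ∪ (range n).biUnion A) ≤ ∑ i ∈ range n, f (O ∪ A i) by
    linarith [h0 (O ∪ (range n).biUnion A)]
  induction n with
  | zero => simp
  | succ n ih =>
    have h := hf.union_add_inter_le (O ∪ A n) (O ∪ (range n).biUnion A)
    have h1 : (O ∪ A n) ∩ (O ∪ (range n).biUnion A) = O := by
      rw [← union_inter_distrib_left, union_eq_left]
      have : Disjoint (A n) ((range n).biUnion A) := by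
        rw [disjoint_biUnion_right]
        exact fun i hi => hA _ _ (mem_range.1 hi).ne'
      rw [disjoint_iff_inter_eq_empty.1 this]; exact empty_subset _
    have h2 : (O ∪ A n) ∪ (O ∪ (range n).biUnion A) = O ∪ (range (n + 1)).biUnion A := by
      rw [range_add_one, biUnion_insert, ← union_union_distrib_left]
    rw [h1, h2] at h
    rw [sum_range_succ]
    push_cast
    linarith

end SetFunctions

/-! ### Exchanges and spans in matroids -/

section Matroids

variable {N : Type*} [DecidableEq N] {M : Matroid N}

omit [DecidableEq N] in
theorem Matroid.Indep.card_le_of_subset_closure {O T : Finset N} (hO : M.Indep (O : Set N))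
    (h : (O : Set N) ⊆ M.closure (T : Set N)) : O.card ≤ T.card := by
  have h1 := M.eRk_mono h
  rw [M.eRk_closure_eq, hO.eRk_eq_encard] at h1
  have h2 := h1.trans (M.eRk_le_encard _)
  simpa [Set.encard_coe_eq_coe_finsetCard] using h2

/-- An independent set each element of which is spanned by the heavier part of `S` weighs at most
as much as `S`. -/
theorem Matroid.Indep.sum_le_sum_of_mem_closure {O S : Finset N} (hO : M.Indep (O : Set N))
    {g W : N → ℝ} (hW : ∀ x, 0 ≤ W x)
    (h : ∀ o ∈ O, o ∈ M.closure {v | v ∈ S ∧ g o < W v}) : ∑ o ∈ O, g o ≤ ∑ v ∈ S, W v := by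
  -- Hall's condition holds because an independent subset of `O` lies in the span of the union of
  -- its neighbourhoods, so it is no larger than that union. The matching `φ` sends each `o` to an
  -- element of `S` of larger weight.
  obtain ⟨φ, hφ, hmem⟩ := (Finset.all_card_le_biUnion_card_iff_exists_injective
      (fun o : O => {v ∈ S | g o < W v})).1 (by
    intro s
    have h1 : (s.map (Function.Embedding.subtype _)).card ≤
        (s.biUnion (fun o : O => {v ∈ S | g o < W v})).card := by
      apply Matroid.Indep.card_le_of_subset_closure (M := M)
      · exact hO.subset (fun x hx => by simp at hx ⊢; exact hx.1)
      · intro x hx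
        simp only [coe_map, Set.mem_image, mem_coe] at hx
        obtain ⟨o, ho, rfl⟩ := hx
        refine M.closure_subset_closure ?_ (h o o.2)
        intro v hv
        simp only [coe_biUnion, Set.mem_iUnion, mem_coe, mem_filter]
        exact ⟨o, ho, hv⟩
    simpa using h1)
  calc ∑ o ∈ O, g o = ∑ o : O, g o := (sum_coe_sort O g).symm
    _ ≤ ∑ o : O, W (φ o) := sum_le_sum fun o _ => (mem_filter.1 (hmem o)).2.le
    _ = ∑ v ∈ univ.image φ, W v := (sum_image (fun a _ b _ e => hφ e)).symm
    _ ≤ ∑ v ∈ S, W v := sum_le_sum_of_subset_of_nonneg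
        (fun v hv => by
          obtain ⟨o, -, rfl⟩ := mem_image.1 hv
          exact (mem_filter.1 (hmem o)).1) (fun x _ _ => hW x)

/-- `u` can replace the subset `V` of `S`, and `V` is spanned by `u` and the elements of the rest
that are not lighter. -/
structure IsSwap (M : Matroid N) (S : Finset N) (ω : N → ℝ) (u : N) (V : Finset N) : Prop where
  subset : V ⊆ S
  indep : M.Indep (insert u (S \ V) : Finset N)
  exch : ∀ v ∈ V, v ∈ M.closure {x | x = u ∨ (x ∈ S \ V ∧ ω v ≤ ω x)}

theorem IsSwap.empty {S : Finset N} {ω : N → ℝ} {u : N} (h : M.Indep (insert u S : Finset N)) :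
    IsSwap M S ω u ∅ := ⟨by simp, by simpa using h, by simp⟩

theorem IsSwap.congr {S V : Finset N} {ω ω' : N → ℝ} {u : N} (h : IsSwap M S ω u V)
    (hω : ∀ x ∈ S, ω' x = ω x) : IsSwap M S ω' u V := by
  refine ⟨h.subset, h.indep, fun v hv => M.closure_subset_closure ?_ (h.exch v hv)⟩
  rintro x (hx | ⟨hx, hvx⟩)
  · exact .inl hx
  · exact .inr ⟨hx, by rwa [hω v (h.subset hv), hω x (mem_sdiff.1 hx).1]⟩

theorem mem_closure_of_not_indep_insert {S : Finset N} {u : N} (hE : M.E = Set.univ)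
    (hS : M.Indep (S : Set N)) (h : ¬ M.Indep (insert u S : Finset N)) :
    u ∈ M.closure (S : Set N) := by
  by_contra hu
  rw [hS.notMem_closure_iff (by simp [hE])] at hu
  exact h (by simpa using hu.1)

/-- Links the fundamental circuit to single exchanges, which is all that the independence oracle can
test. -/
theorem mem_fundCircuit_cases {S : Finset N} {u x : N} (huS : u ∉ S)
    (hS : M.Indep (S : Set N)) (hcl : u ∈ M.closure (S : Set N))
    (hx : x ∈ M.fundCircuit u (S : Set N)) :
    x = u ∨ x ∈ S ∧ M.Indep (insert u (S.erase x) : Finset N) := by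
  by_cases hxu : x = u
  · exact .inl hxu
  have h1 := M.fundCircuit_subset_insert u S hx
  rw [hS.mem_fundCircuit_iff hcl (by simpa using huS)] at hx
  refine .inr ⟨by simpa [hxu] using h1, ?_⟩
  rw [coe_insert, coe_erase, Set.insert_sdiff_singleton_comm (Ne.symm hxu)]
  exact hx

/-- A lightest exchange candidate `v` lies on the fundamental circuit of `u`. The rest of the
circuit spans `v`, and apart from `u` it consists of candidates, none lighter than `v`. -/
theorem IsSwap.singleton {S : Finset N} {ω : N → ℝ} {u v : N} (hE : M.E = Set.univ) (huS : u ∉ S)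
    (hS : M.Indep (S : Set N)) (hdep : ¬ M.Indep (insert u S : Finset N)) (hv : v ∈ S)
    (hind : M.Indep (insert u (S.erase v) : Finset N))
    (hmin : ∀ x ∈ S, M.Indep (insert u (S.erase x) : Finset N) → ω v ≤ ω x) :
    IsSwap M S ω u {v} := by
  refine ⟨by simpa using hv, by rwa [sdiff_singleton_eq_erase], ?_⟩
  have hcl := mem_closure_of_not_indep_insert hE hS hdep
  have hne : v ≠ u := fun h => huS (h ▸ hv)
  have hvC : v ∈ M.fundCircuit u (S : Set N) := by
    rw [hS.mem_fundCircuit_iff hcl (by simpa using huS),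
      ← Set.insert_sdiff_singleton_comm hne.symm]
    simpa using hind
  intro v' hv'
  obtain rfl := mem_singleton.1 hv'
  refine M.closure_subset_closure ?_
    ((hS.fundCircuit_isCircuit hcl (by simpa using huS)).mem_closure_sdiff_singleton_of_mem hvC)
  rintro x ⟨hx, hxv⟩
  rcases mem_fundCircuit_cases huS hS hcl hx with rfl | ⟨h1, h2⟩
  · exact .inl rfl
  · exact .inr ⟨by simpa [h1] using hxv, hmin x h1 h2⟩

/-- If `u` is not acceptable, it is spanned by the heavy elements. -/
theorem mem_closure_of_not_acceptable {S : Finset N} {ω : N → ℝ} {u : N} {d : ℝ}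
    (hE : M.E = Set.univ) (huS : u ∉ S) (hS : M.Indep (S : Set N))
    (hdep : ¬ M.Indep (insert u S : Finset N))
    (h : ∀ x ∈ S, M.Indep (insert u (S.erase x) : Finset N) → d < 2 * ω x) :
    u ∈ M.closure {v | v ∈ S ∧ d < 2 * ω v} := by
  have hcl := mem_closure_of_not_indep_insert hE hS hdep
  -- The fundamental circuit without `u` spans `u`, and all its elements are exchange candidates,
  -- hence heavy.
  refine M.closure_subset_closure ?_
    ((hS.fundCircuit_isCircuit hcl (by simpa using huS)).mem_closure_sdiff_singleton_of_mem
      (M.mem_fundCircuit u S))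
  rintro x ⟨hx, hxu⟩
  rcases mem_fundCircuit_cases huS hS hcl hx with rfl | ⟨h1, h2⟩
  · exact absurd rfl hxu
  · exact ⟨h1, h x h1 h2⟩

/-- A removed element above the threshold is spanned by `u` and by kept elements, all at least as
heavy as itself and so above the threshold too. -/
theorem IsSwap.closure_subset {S V : Finset N} {ω : N → ℝ} {u : N} {t : ℝ} (hE : M.E = Set.univ)
    (h : IsSwap M S ω u V) (hlt : ∀ v ∈ V, ω v ≤ ω u) :
    M.closure {v | v ∈ S ∧ t < 2 * ω v} ⊆
      M.closure {v | v ∈ insert u (S \ V) ∧ t < 2 * ω v} := by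
  apply M.closure_subset_closure_of_subset_closure
  rintro x ⟨hx, hxt⟩
  by_cases hxV : x ∈ V
  · refine M.closure_subset_closure ?_ (h.exch x hxV)
    rintro y (rfl | ⟨hy, hxy⟩)
    · exact ⟨by simp, by linarith [hlt x hxV]⟩
    · exact ⟨by simp [hy], by linarith⟩
  · exact M.mem_closure_of_mem' ⟨by simp [hx, hxV], hxt⟩ (by simp [hE])

end Matroids

/-! ### The invariant of the exchange algorithm and the approximation ratio -/

section Invariant

variable {N : Type*} [DecidableEq N]

/-- The total weight of the solutions of the first `n` classes. -/
noncomputable def totalWeight (n : ℕ) (S : ℕ → Finset N) (ω : N → ℝ) : ℝ :=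
  ∑ i ∈ range n, ∑ x ∈ S i, ω x

/-- The invariant of the exchange algorithm with `n` classes, after the elements of `P` have
arrived. The elements of `H` are in memory; class `i` has the solution `S i` and has accepted the
elements of `A i` so far, with weights given by `ω`. -/
structure ExchangeInv (f : Finset N → ℝ) (M : Matroid N) (n : ℕ) (q : ℝ) (P H : Finset N)
    (S A : ℕ → Finset N) (ω : N → ℝ) : Prop where
  sol_subset : ∀ i, S i ⊆ A i
  sol_held : ∀ i, S i ⊆ H
  acc_subset : ∀ i, A i ⊆ P
  acc_empty : ∀ i, n ≤ i → A i = ∅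
  held_acc : ∀ x ∈ H, ∃ i < n, x ∈ A i
  disj : ∀ i j, i ≠ j → Disjoint (A i) (A j)
  indep : ∀ i, M.Indep (S i : Set N)
  pos : ∀ i, ∀ x ∈ A i, 0 < ω x
  nonneg : ∀ x, 0 ≤ ω x
  lower : ∀ i, ∀ T ⊆ S i, f ∅ + ∑ x ∈ T, ω x ≤ f T
  upper : ∀ i, f (A i) ≤ f ∅ + ∑ x ∈ A i, ω x
  charge : ∀ i, ∑ x ∈ A i, ω x ≤ 2 * ∑ x ∈ S i, ω x
  lost : ∀ x ∈ P, x ∉ H → q * ω x ≤ totalWeight n S ω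
  span : ∀ x ∈ P, ∀ i < n, f (insert x (A i)) - f (A i) ≤ ω x ∨
    x ∈ M.closure {v | v ∈ S i ∧ f (insert x (A i)) - f (A i) < 2 * ω v}

variable {f : Finset N → ℝ} {M : Matroid N} {n : ℕ} {q : ℝ} {P H : Finset N}
    {S A : ℕ → Finset N} {ω : N → ℝ}

theorem ExchangeInv.init : ExchangeInv f M n q ∅ ∅ (fun _ => ∅) (fun _ => ∅) (fun _ => 0) := by
  constructor <;> simp

namespace ExchangeInv

theorem held_subset (h : ExchangeInv f M n q P H S A ω) : H ⊆ P := fun x hx => by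
  obtain ⟨i, -, hi⟩ := h.held_acc x hx
  exact h.acc_subset i hi

theorem sum_congr_update {T : Finset N} {u : N} {d : ℝ} (hu : u ∉ T) :
    ∑ x ∈ T, Function.update ω u d x = ∑ x ∈ T, ω x :=
  sum_congr rfl fun _ hx => Function.update_of_ne (ne_of_mem_of_not_mem hx hu) _ _

theorem totalWeight_nonneg (h : ExchangeInv f M n q P H S A ω) : 0 ≤ totalWeight n S ω :=
  sum_nonneg fun _ _ => sum_nonneg fun _ _ => h.nonneg _

theorem notMem_acc (h : ExchangeInv f M n q P H S A ω) {u : N} (hu : u ∉ P) (i : ℕ) : u ∉ A i :=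
  fun hi => hu (h.acc_subset i hi)

theorem notMem_sol (h : ExchangeInv f M n q P H S A ω) {u : N} (hu : u ∉ P) (i : ℕ) : u ∉ S i :=
  fun hi => h.notMem_acc hu i (h.sol_subset i hi)

/-- The weight of an element that has not arrived is immaterial. -/
theorem update_weight (h : ExchangeInv f M n q P H S A ω) {u : N} (hu : u ∉ P) {d : ℝ}
    (hd : 0 ≤ d) : ExchangeInv f M n q P H S A (Function.update ω u d) := by
  have hne : ∀ x ∈ P, x ≠ u := fun x hx e => hu (e ▸ hx)
  have hval : ∀ x ∈ P, Function.update ω u d x = ω x := fun x hx =>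
    Function.update_of_ne (hne x hx) _ _
  have hS : ∀ i, ∑ x ∈ S i, Function.update ω u d x = ∑ x ∈ S i, ω x := fun i =>
    sum_congr_update (h.notMem_sol hu i)
  have hA : ∀ i, ∑ x ∈ A i, Function.update ω u d x = ∑ x ∈ A i, ω x := fun i =>
    sum_congr_update (h.notMem_acc hu i)
  refine ⟨h.sol_subset, h.sol_held, h.acc_subset, h.acc_empty, h.held_acc, h.disj, h.indep, ?_, ?_, ?_, ?_, ?_,
    ?_, ?_⟩
  · intro i x hx
    rw [hval x (h.acc_subset i hx)]
    exact h.pos i x hx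
  · intro x
    rw [Function.update_apply]
    split_ifs
    · exact hd
    · exact h.nonneg x
  · intro i T hT
    rw [sum_congr_update (fun hx => h.notMem_sol hu i (hT hx))]
    exact h.lower i T hT
  · intro i
    rw [hA]
    exact h.upper i
  · intro i
    rw [hA, hS]
    exact h.charge i
  · intro x hx hxH
    rw [hval x hx, totalWeight]
    simp_rw [hS]
    exact h.lost x hx hxH
  · intro x hx i hi
    rw [hval x hx]
    refine (h.span x hx i hi).imp_right fun hc => M.closure_subset_closure ?_ hc
    rintro v ⟨hv, hlt⟩
    exact ⟨hv, by rwa [hval v (h.acc_subset i (h.sol_subset i hv))]⟩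

/-- What a class that is not chosen knows about the arriving element `u`. -/
def Passed (f : Finset N → ℝ) (M : Matroid N) (S : Finset N) (ω : N → ℝ) (u : N) (d : ℝ) : Prop :=
  f (insert u S) - f S ≤ d ∨ (¬ M.Indep (insert u S : Finset N) ∧
    ∀ x ∈ S, M.Indep (insert u (S.erase x) : Finset N) → f (insert u S) - f S < 2 * ω x)

theorem passed_span (h : ExchangeInv f M n q P H S A ω) (hf : IsSubmodular f)
    (hE : M.E = Set.univ) {u : N} (hu : u ∉ P) {d : ℝ} {i : ℕ} (hp : Passed f M (S i) ω u d) :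
    f (insert u (A i)) - f (A i) ≤ d ∨
      u ∈ M.closure {v | v ∈ S i ∧ f (insert u (A i)) - f (A i) < 2 * ω v} := by
  have h1 : f (insert u (A i)) - f (A i) ≤ f (insert u (S i)) - f (S i) :=
    hf _ _ (h.sol_subset i) u (h.notMem_acc hu i)
  rcases hp with hp | ⟨h2, h3⟩
  · exact .inl (h1.trans hp)
  · exact .inr (mem_closure_of_not_acceptable hE (h.notMem_sol hu i) (h.indep i) h2
      fun x hx hxi => h1.trans_lt (h3 x hx hxi))

theorem Passed.congr {T : Finset N} {ω' : N → ℝ} {u : N} {d : ℝ}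
    (h : Passed f M T ω u d) (hω : ∀ x ∈ T, ω' x = ω x) : Passed f M T ω' u d :=
  h.imp_right fun h => ⟨h.1, fun x hx hxi => by rw [hω x hx]; exact h.2 x hx hxi⟩

/-- The arriving element is rejected by all classes. -/
theorem reject (h : ExchangeInv f M n q P H S A ω) (hf : IsSubmodular f) (hE : M.E = Set.univ)
    {u : N} (hu : u ∉ P) (hp : ∀ i < n, Passed f M (S i) ω u 0) :
    ExchangeInv f M n q (insert u P) H S A (Function.update ω u 0) := by
  have h' := h.update_weight hu le_rfl
  have hpos := h'.totalWeight_nonneg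
  refine ⟨h'.sol_subset, h'.sol_held, fun i => (h'.acc_subset i).trans (subset_insert _ _),
    h'.acc_empty, h'.held_acc, h'.disj, h'.indep, h'.pos, h'.nonneg, h'.lower, h'.upper, h'.charge, ?_, ?_⟩
  · intro x hx hxH
    rcases mem_insert.1 hx with rfl | hx
    · simpa using hpos
    · exact h'.lost x hx hxH
  · intro x hx i hi
    rcases mem_insert.1 hx with rfl | hx
    · refine h'.passed_span hf hE hu ?_
      rw [Function.update_self]
      exact (hp i hi).congr fun y hy =>
        Function.update_of_ne (ne_of_mem_of_not_mem hy (h'.notMem_sol hu i)) _ _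
    · exact h'.span x hx i hi

theorem totalWeight_swap {u : N} {V : Finset N} {j : ℕ} (hj : j < n) (hu : u ∉ S j)
    (hV : V ⊆ S j) :
    totalWeight n (Function.update S j (insert u (S j \ V))) ω =
      totalWeight n S ω + (ω u - ∑ v ∈ V, ω v) := by
  have hj' : j ∈ range n := mem_range.2 hj
  have h1 : ∑ i ∈ (range n).erase j, ∑ x ∈ Function.update S j (insert u (S j \ V)) i, ω x =
      ∑ i ∈ (range n).erase j, ∑ x ∈ S i, ω x :=
    sum_congr rfl fun i hi => by rw [Function.update_of_ne (ne_of_mem_erase hi)]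
  rw [totalWeight, totalWeight, ← add_sum_erase _ _ hj',
    ← add_sum_erase (range n) (fun i => ∑ x ∈ S i, ω x) hj', h1, Function.update_self,
    sum_insert (by simp [hu]), ← sum_sdiff hV]
  ring

/-- Class `j` accepts the arriving element `u` of weight `ω u` and removes `V`; the elements of
`H \ H'` are lost. -/
theorem accept (h : ExchangeInv f M n q P H S A ω) (hf : IsSubmodular f) (hE : M.E = Set.univ)
    {u : N} (hu : u ∉ P) {j : ℕ} (hj : j < n)
    (hωu : ω u = f (insert u (S j)) - f (S j)) (hpos : 0 < ω u) {V : Finset N}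
    (hV : IsSwap M (S j) ω u V) (hVu : 2 * ∑ v ∈ V, ω v ≤ ω u)
    (hp : ∀ i < n, Passed f M (S i) ω u (ω u)) {H' : Finset N} (hH' : H' ⊆ H)
    (hSH : ∀ i, i ≠ j → S i ⊆ H') (hSj : S j \ V ⊆ H')
    (hlost : ∀ x ∈ H, x ∉ H' → q * ω x ≤ totalWeight n S ω + (ω u - ∑ v ∈ V, ω v)) :
    ExchangeInv f M n q (insert u P) (insert u H') (Function.update S j (insert u (S j \ V)))
      (Function.update A j (insert u (A j))) ω := by
  have huA := h.notMem_acc hu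
  have huS := h.notMem_sol hu
  have hVsum : ∀ v ∈ V, ω v ≤ ∑ v ∈ V, ω v := fun v hv =>
    single_le_sum (f := ω) (fun x _ => h.nonneg x) hv
  have hVnn : 0 ≤ ∑ v ∈ V, ω v := sum_nonneg fun x _ => h.nonneg x
  have hle : ∀ v ∈ V, ω v ≤ ω u := fun v hv => by linarith [hVsum v hv]
  have htot := totalWeight_swap (ω := ω) hj (huS j) hV.subset
  have hAcc : ∀ i, A i ⊆ Function.update A j (insert u (A j)) i := fun i => by
    rcases eq_or_ne i j with rfl | hi
    · simp
    · simp [hi]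
  -- The gain over the larger set `A j` is at most the gain over `S j`; this gives the upper bound
  -- on `f (A j)`.
  have hself : f (insert u (A j)) - f (A j) ≤ ω u := hωu ▸ hf _ _ (h.sol_subset j) u (huA j)
  refine ⟨?_, ?_, ?_, ?_, ?_, ?_, ?_, ?_, h.nonneg, ?_, ?_, ?_, ?_, ?_⟩
  · intro i
    rcases eq_or_ne i j with rfl | hi
    · simpa using insert_subset_insert u (sdiff_subset.trans (h.sol_subset i))
    · simpa [hi] using h.sol_subset i
  · intro i
    rcases eq_or_ne i j with rfl | hi
    · simpa using insert_subset_insert u hSj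
    · simpa [hi] using (hSH i hi).trans (subset_insert _ _)
  · intro i
    rcases eq_or_ne i j with rfl | hi
    · simpa using insert_subset_insert u (h.acc_subset i)
    · simpa [hi] using (h.acc_subset i).trans (subset_insert _ _)
  · intro i hi
    rw [Function.update_of_ne (by omega)]
    exact h.acc_empty i hi
  · intro x hx
    rcases mem_insert.1 hx with rfl | hx
    · exact ⟨j, hj, by simp⟩
    · obtain ⟨i, hi, hxi⟩ := h.held_acc x (hH' hx)
      exact ⟨i, hi, hAcc i hxi⟩
  · intro a b hab
    rcases eq_or_ne a j with rfl | ha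
    · simpa [hab.symm, huA] using h.disj a b hab
    · rcases eq_or_ne b j with rfl | hb
      · simpa [ha, huA] using h.disj a b hab
      · simpa [ha, hb] using h.disj a b hab
  · intro i
    rcases eq_or_ne i j with rfl | hi
    · simpa using hV.indep
    · simpa [hi] using h.indep i
  · intro i x hx
    rcases eq_or_ne i j with rfl | hi
    · rcases mem_insert.1 (by simpa using hx) with rfl | hx
      · exact hpos
      · exact h.pos i x hx
    · exact h.pos i x (by simpa [hi] using hx)
  · intro i T hT
    rcases eq_or_ne i j with rfl | hi
    · rw [Function.update_self] at hT
      have hsub : T.erase u ⊆ S i := fun x hx => by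
        have := hT (mem_of_mem_erase hx)
        simp only [mem_insert, mem_sdiff, ne_of_mem_erase hx, false_or] at this
        exact this.1
      have h1 := h.lower i _ hsub
      -- The gain of `u` over `T.erase u ⊆ S j` is at least its gain over `S j`, which is `ω u`.
      by_cases huT : u ∈ T
      · have h2 := hf _ _ hsub u (huS i)
        rw [insert_erase huT, ← hωu] at h2
        rw [← add_sum_erase T ω huT]
        linarith
      · rwa [erase_eq_of_notMem huT] at h1
    · exact h.lower i T (by simpa [hi] using hT)
  · intro i
    rcases eq_or_ne i j with rfl | hi
    · rw [Function.update_self, sum_insert (huA i)]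
      linarith [h.upper i]
    · simpa [hi] using h.upper i
  · intro i
    rcases eq_or_ne i j with rfl | hi
    · rw [Function.update_self, Function.update_self, sum_insert (huA i),
        sum_insert (by simp [huS i])]
      -- The removed weight is at most `ω u / 2`, so twice the weight of the solution grows by at
      -- least `ω u`.
      have := h.charge i
      rw [← sum_sdiff hV.subset] at this
      linarith
    · simpa [hi] using h.charge i
  · intro x hx hxH
    rw [htot]
    simp only [mem_insert, not_or] at hx hxH
    rcases hx with hx | hx
    · exact absurd hx hxH.1
    · by_cases hxH0 : x ∈ H
      · exact hlost x hxH0 hxH.2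
      -- The total weight does not decrease, so elements lost earlier stay light.
      · linarith [h.lost x hx hxH0]
  -- Enlarging `A j` lowers gains, hence the threshold on weights, and the swap does not shrink the
  -- span of the elements above a threshold.
  · have key : ∀ x i, (f (insert x (A i)) - f (A i) ≤ ω x ∨
        x ∈ M.closure {v | v ∈ S i ∧ f (insert x (A i)) - f (A i) < 2 * ω v}) →
        i = j → x ≠ u →
        (f (insert x (insert u (A i))) - f (insert u (A i)) ≤ ω x ∨
        x ∈ M.closure {v | v ∈ insert u (S i \ V) ∧
          f (insert x (insert u (A i))) - f (insert u (A i)) < 2 * ω v}) := by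
      rintro x i hx rfl hxu
      have hmono : f (insert x (insert u (A i))) - f (insert u (A i)) ≤
          f (insert x (A i)) - f (A i) :=
        hf.insert_union_sub_le (subset_insert u (A i)) x (by simp [hxu])
      refine hx.imp hmono.trans fun hx => ?_
      refine hV.closure_subset hE hle (M.closure_subset_closure ?_ hx)
      exact fun v hv => ⟨hv.1, hmono.trans_lt hv.2⟩
    intro x hx i hi
    rcases eq_or_ne i j with rfl | hij
    · rw [Function.update_self, Function.update_self]
      rcases mem_insert.1 hx with rfl | hx
      · left; simpa using hpos.le
      · exact key x i (h.span x hx i hi) rfl (fun e => hu (e ▸ hx))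
    · rw [Function.update_of_ne hij, Function.update_of_ne hij]
      rcases mem_insert.1 hx with rfl | hx
      · exact h.passed_span hf hE hu (hp i hi)
      · exact h.span x hx i hi

/-- There are few heavy elements in memory. -/
theorem card_heavy_le (h : ExchangeInv f M n q P H S A ω) (hq : 0 ≤ q) {W : ℝ}
    (hW : totalWeight n S ω ≤ W) : ((H.filter fun x => W < q * ω x).card : ℝ) ≤ 2 * q := by
  have hH : ∑ x ∈ H, ω x ≤ 2 * totalWeight n S ω := by
    calc ∑ x ∈ H, ω x ≤ ∑ x ∈ (range n).biUnion A, ω x :=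
          sum_le_sum_of_subset_of_nonneg (fun x hx => by
            obtain ⟨i, hi, hxi⟩ := h.held_acc x hx
            exact mem_biUnion.2 ⟨i, mem_range.2 hi, hxi⟩) fun x _ _ => h.nonneg x
      _ = ∑ i ∈ range n, ∑ x ∈ A i, ω x := sum_biUnion fun i _ j _ hij => h.disj i j hij
      _ ≤ ∑ i ∈ range n, 2 * ∑ x ∈ S i, ω x := sum_le_sum fun i _ => h.charge i
      _ = 2 * totalWeight n S ω := by rw [totalWeight, mul_sum]
  set G := H.filter fun x => W < q * ω x with hG
  have h0 := h.totalWeight_nonneg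
  by_cases hne : G = ∅
  · simp only [hne, card_empty, Nat.cast_zero]; linarith
  -- Accepted elements have positive weight, so a nonempty memory forces `W > 0`, which permits
  -- cancelling `W`.
  have hWpos : 0 < W := by
    obtain ⟨x, hx⟩ := nonempty_of_ne_empty hne
    have hxH := (mem_filter.1 hx).1
    obtain ⟨i, hi, hxi⟩ := h.held_acc x hxH
    have h1 := h.pos i x hxi
    have h2 := single_le_sum (f := ω) (fun y _ => h.nonneg y) hxH
    linarith
  have h1 : (G.card : ℝ) * W ≤ q * ∑ x ∈ G, ω x := by
    rw [mul_sum, ← nsmul_eq_mul]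
    exact card_nsmul_le_sum _ _ _ fun x hx => (mem_filter.1 hx).2.le
  have h2 : ∑ x ∈ G, ω x ≤ ∑ x ∈ H, ω x :=
    sum_le_sum_of_subset_of_nonneg (filter_subset _ _) fun x _ _ => h.nonneg x
  have h3 : (G.card : ℝ) * W ≤ 2 * q * W := by nlinarith
  exact le_of_mul_le_mul_right h3 hWpos

/-- The approximation guarantee: the best independent subset of the memory is good enough. -/
theorem guarantee [Fintype N] {k : ℕ} (h : ExchangeInv f M n q univ H S A ω)
    (hf : IsSubmodular f) (h0 : ∀ S, 0 ≤ f S) (hq : 10 * (n : ℝ) * k ≤ q) (hq0 : 0 < q)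
    (hk : M.eRank = k) {b : ℝ} (hb : ∀ T ⊆ H, M.Indep (T : Set N) → f T ≤ b) {O : Finset N}
    (hO : M.Indep (O : Set N)) : ((n : ℝ) - 1) * f O ≤ 5.1 * n * b := by
  have hSb : ∀ i, f (S i) ≤ b := fun i => hb _ (h.sol_held i) (h.indep i)
  have hlow : ∀ i, f ∅ + ∑ x ∈ S i, ω x ≤ f (S i) := fun i => h.lower i _ Subset.rfl
  have hb0 : 0 ≤ b := (h0 _).trans (hSb 0)
  have hW : totalWeight n S ω ≤ n * b := by
    calc totalWeight n S ω ≤ ∑ i ∈ range n, b :=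
          sum_le_sum fun i _ => by linarith [hlow i, hSb i, h0 ∅]
      _ = n * b := by simp
  set O₂ := O \ H with hO₂
  have hcard : ((O₂.card : ℕ) : ℝ) ≤ k := by
    have h1 : M.Indep (O₂ : Set N) := hO.subset (by simp [hO₂])
    have h2 := h1.encard_le_eRank
    rw [hk, Set.encard_coe_eq_coe_finsetCard] at h2
    exact_mod_cast h2
  have hω : ∀ o ∈ O₂, ω o ≤ n * b / q := fun o ho => by
    rw [le_div_iff₀ hq0]
    linarith [h.lost o (mem_univ _) (mem_sdiff.1 ho).2]
  -- The reason for the factor `10` in `q`: at most `k` lost elements together contribute at most `b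
  -- / 10`.
  have hkq : (k : ℝ) * (n * b / q) ≤ b / 10 := by
    rw [mul_div_assoc', div_le_iff₀ hq0]
    nlinarith
  have hgain : ∀ i < n, ∑ o ∈ O₂, (f (insert o (A i)) - f (A i)) ≤
      b / 10 + 2 * ∑ x ∈ S i, ω x := by
    intro i hi
    set g : N → ℝ := fun o => f (insert o (A i)) - f (A i) with hg
    -- The two alternatives of `span`: gains bounded by the small weights of lost elements, and
    -- gains matched to elements of `S i` by Hall's theorem.
    rw [← sum_filter_add_sum_filter_not O₂ (fun o => g o ≤ ω o)]
    have h1 : ∑ o ∈ O₂ with g o ≤ ω o, g o ≤ b / 10 := by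
      have hnn : 0 ≤ n * b / q := by positivity
      calc ∑ o ∈ O₂ with g o ≤ ω o, g o ≤ (O₂.filter fun o => g o ≤ ω o).card • (n * b / q) :=
            sum_le_card_nsmul _ _ _ fun o ho =>
              (mem_filter.1 ho).2.trans (hω o (mem_filter.1 ho).1)
        _ ≤ k * (n * b / q) := by
            rw [nsmul_eq_mul]
            refine mul_le_mul_of_nonneg_right ?_ hnn
            refine le_trans ?_ hcard
            exact_mod_cast card_filter_le _ _
        _ ≤ b / 10 := hkq
    have h2 : ∑ o ∈ O₂ with ¬ g o ≤ ω o, g o ≤ ∑ x ∈ S i, 2 * ω x := by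
      apply Matroid.Indep.sum_le_sum_of_mem_closure (M := M)
      · refine hO.subset fun x hx => ?_
        simp only [coe_filter, Set.mem_ofPred_eq, hO₂, mem_sdiff] at hx
        exact hx.1.1
      · exact fun x => by linarith [h.nonneg x]
      · intro o ho
        exact (h.span o (mem_univ _) i hi).resolve_left (mem_filter.1 ho).2
    rw [← mul_sum] at h2
    linarith
  have hO₁ : f (O ∩ H) ≤ b := hb _ inter_subset_right (hO.subset (by simp))
  have hmain : ∀ i < n, f (O ∪ A i) ≤ 5.1 * b := by
    intro i hi
    have h1 := hf.union_add_inter_le (O₂ ∪ A i) (O ∩ H)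
    have h2 : O₂ ∪ A i ∪ O ∩ H = O ∪ A i := by
      rw [union_right_comm, hO₂, sdiff_union_inter]
    rw [h2] at h1
    -- The constant: `b` for `O ∩ H`, `b / 10` for light gains, and `f ∅ + 4 ω(S i) ≤ 4 b`, half of
    -- it from `f (A i)` and half from the matched gains.
    linarith [h0 ((O₂ ∪ A i) ∩ (O ∩ H)), hf.union_sub_le_sum (A i) O₂, hgain i hi, h.upper i,
      h.charge i, hlow i, hSb i, h0 ∅]
  calc ((n : ℝ) - 1) * f O ≤ ∑ i ∈ range n, f (O ∪ A i) := hf.sum_union_ge h0 O A h.disj n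
    _ ≤ ∑ i ∈ range n, 5.1 * b := sum_le_sum fun i hi => hmain i (mem_range.1 hi)
    _ = 5.1 * n * b := by simp; ring

end ExchangeInv

end Invariant

/-! ### Finite sets as binary numbers -/

section Codes

/-- The binary number whose digit `j` is one exactly for `j ∈ J`. -/
def bitCode (J : Finset ℕ) : ℕ := ∑ j ∈ J, 2 ^ j

theorem testBit_bitCode (J : Finset ℕ) (j : ℕ) : (bitCode J).testBit j = true ↔ j ∈ J := by
  rw [← Nat.mem_bitIndices, ← List.mem_toFinset, bitCode, Finset.toFinset_bitIndices_sum_two_pow]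

theorem bitCode_lt {J : Finset ℕ} {K : ℕ} (h : ∀ j ∈ J, j < K) : bitCode J < 2 ^ K :=
  Nat.geomSum_lt le_rfl h

theorem bitCode_insert {J : Finset ℕ} {j : ℕ} (h : j ∉ J) :
    bitCode (insert j J) = bitCode J + 2 ^ j := by
  rw [bitCode, sum_insert h, add_comm, bitCode]

theorem bitCode_sdiff {J I : Finset ℕ} (h : I ⊆ J) : bitCode (J \ I) = bitCode J - bitCode I := by
  have := sum_sdiff (f := fun j => 2 ^ j) h
  unfold bitCode
  omega

theorem bitCode_erase {J : Finset ℕ} {j : ℕ} (h : j ∈ J) :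
    bitCode (J.erase j) = bitCode J - 2 ^ j := by
  rw [← sdiff_singleton_eq_erase, bitCode_sdiff (by simpa using h)]
  simp [bitCode]

end Codes

namespace StreamMachine

/-! ### Total correctness with a memory bound -/

section Logic

variable {N : Type*} [Fintype N] {f : Finset N → ℝ} {M : Matroid N} {W : State N → Prop}

theorem Exec.mono {W' : State N → Prop} (hW : ∀ s, W s → W' s) {p : Cmd} {s t : State N}
    (h : Exec f M W p s t) : Exec f M W' p s t := by
  induction h with
  | skip h => exact .skip (hW _ h)
  | setNat h h' => exact .setNat (hW _ h) (hW _ h')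
  | setReal h h' => exact .setReal (hW _ h) (hW _ h')
  | copyElem h h' => exact .copyElem (hW _ h) (hW _ h')
  | clearElem h h' => exact .clearElem (hW _ h) (hW _ h')
  | seq _ _ h h' => exact .seq h h'
  | iteTrue hb _ h => exact .iteTrue hb h
  | iteFalse hb _ h => exact .iteFalse hb h
  | whileTrue hb _ _ h h' => exact .whileTrue hb h h'
  | whileFalse hb h => exact .whileFalse hb (hW _ h)

/-- Total correctness: `p` started in `s` stops in a state that satisfies `Q`, and all states on
the way satisfy `W`. -/
def Runs (f : Finset N → ℝ) (M : Matroid N) (W : State N → Prop) (p : Cmd) (s : State N)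
    (Q : State N → Prop) : Prop :=
  ∃ t, Exec f M W p s t ∧ Q t

namespace Runs

variable {p q : Cmd} {s : State N} {Q Q' : State N → Prop} {b : Test}

theorem mono (h : Runs f M W p s Q) (hQ : ∀ t, Q t → Q' t) : Runs f M W p s Q' :=
  let ⟨t, h, h'⟩ := h
  ⟨t, h, hQ t h'⟩

theorem skip (hs : W s) (h : Q s) : Runs f M W .skip s Q := ⟨s, .skip hs, h⟩

theorem seq (h : Runs f M W p s fun t => Runs f M W q t Q) : Runs f M W (.seq p q) s Q :=
  let ⟨_, h, r, h', hr⟩ := h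
  ⟨r, .seq h h', hr⟩

theorem seq_of (h : Runs f M W p s Q') (h' : ∀ t, Q' t → Runs f M W q t Q) :
    Runs f M W (.seq p q) s Q :=
  seq (h.mono h')

theorem ite (h : b.eval f M s → Runs f M W p s Q) (h' : ¬ b.eval f M s → Runs f M W q s Q) :
    Runs f M W (.ite b p q) s Q := by
  by_cases hb : b.eval f M s
  · obtain ⟨t, ht, hQ⟩ := h hb
    exact ⟨t, .iteTrue hb ht, hQ⟩
  · obtain ⟨t, ht, hQ⟩ := h' hb
    exact ⟨t, .iteFalse hb ht, hQ⟩

/-- The variant `μ` strictly decreases, so the loop terminates; the invariant `I` includes the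
memory bound. -/
theorem loop (I : State N → Prop) (μ : State N → ℕ) (hW : ∀ t, I t → W t)
    (hQ : ∀ t, I t → ¬ b.eval f M t → Q t)
    (hp : ∀ t, I t → b.eval f M t → Runs f M W p t fun r => I r ∧ μ r < μ t) (hs : I s) :
    Runs f M W (.while b p) s Q := by
  induction hm : μ s using Nat.strong_induction_on generalizing s with
  | _ m ih =>
    by_cases hb : b.eval f M s
    · obtain ⟨t, ht, hI, hlt⟩ := hp s hs hb
      obtain ⟨r, hr, hQr⟩ := ih (μ t) (hm ▸ hlt) hI rfl
      exact ⟨r, .whileTrue hb ht hr, hQr⟩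
    · exact ⟨s, .whileFalse hb (hW s hs), hQ s hs hb⟩

end Runs

/-- A bound for the memory in use: `c` cells for natural numbers below `2 ^ (K + 1)`, and the first
`K` cells for elements and for reals. -/
structure Tame (c K : ℕ) (s : State N) : Prop where
  elem : ∀ j, K ≤ j → s.elem j = none
  real : ∀ j, K ≤ j → s.real j = 0
  nat : ∀ j, c ≤ j → s.nat j = 0
  lt : ∀ j, s.nat j < 2 ^ (K + 1)

-- Each of `c` numbers has at most `K + 1` bits. The extra bit is needed because the counter `2 ^ j`
-- of a scan ends at `2 ^ K`.
omit [Fintype N] in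
theorem Tame.fits {c K K' B : ℕ} {s : State N} (h : Tame c K s) (hK : K ≤ K') (hKB : K ≤ B)
    (hc : c * (K + 1) ≤ B) : s.Fits K' B := by
  have hcB : c ≤ B := by nlinarith
  refine ⟨fun j hj => h.elem j (hK.trans hj), fun j hj => h.real j (hKB.trans hj),
    fun j hj => h.nat j (hcB.trans hj), ?_⟩
  calc ∑ j ∈ range B, (s.nat j).size = ∑ j ∈ range c, (s.nat j).size := by
        refine (sum_subset (range_subset_range.2 hcB) fun j _ hj => ?_).symm
        rw [h.nat j (by simpa using hj), Nat.size_zero]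
    _ ≤ ∑ j ∈ range c, (K + 1) := sum_le_sum fun j _ => Nat.size_le.2 (h.lt j)
    _ = c * (K + 1) := by simp
    _ ≤ B := hc

namespace Runs

variable {c K : ℕ} {s : State N} {Q : State N → Prop}

/-- The rules for assignments describe the new state only through its components, so that later
proofs can rewrite with them. -/
theorem setNat {i e : NatExpr} (hs : Tame c K s) (a v : ℕ) (ha : i.eval s = a) (hv : e.eval s = v)
    (hac : a < c) (hvK : v < 2 ^ (K + 1))
    (h : ∀ t : State N, Tame c K t → t.elem = s.elem → t.real = s.real →
      t.nat = Function.update s.nat a v → Q t) :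
    Runs f M (Tame c K) (.setNat i e) s Q := by
  have ht : Tame c K { s with nat := Function.update s.nat (i.eval s) (e.eval s) } := by
    refine ⟨hs.elem, hs.real, fun j hj => ?_, fun j => ?_⟩
    · rw [ha]
      exact (Function.update_of_ne (by omega) _ _).trans (hs.nat j hj)
    · simp only [Function.update_apply]
      split_ifs
      · rwa [hv]
      · exact hs.lt j
  exact ⟨_, .setNat hs ht, h _ ht rfl rfl (by rw [ha, hv])⟩

theorem setReal {i : NatExpr} {e : RealExpr} (hs : Tame c K s) (a : ℕ) (v : ℝ)
    (ha : i.eval s = a) (hv : e.eval f s = v) (haK : a < K)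
    (h : ∀ t : State N, Tame c K t → t.elem = s.elem → t.nat = s.nat →
      t.real = Function.update s.real a v → Q t) :
    Runs f M (Tame c K) (.setReal i e) s Q := by
  have ht : Tame c K { s with real := Function.update s.real (i.eval s) (e.eval f s) } := by
    refine ⟨hs.elem, fun j hj => ?_, hs.nat, hs.lt⟩
    rw [ha]
    exact (Function.update_of_ne (by omega) _ _).trans (hs.real j hj)
  exact ⟨_, .setReal hs ht, h _ ht rfl rfl (by rw [ha, hv])⟩

theorem copyElem {i e : NatExpr} (hs : Tame c K s) (a v : ℕ) (ha : i.eval s = a)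
    (hv : e.eval s = v) (haK : a < K)
    (h : ∀ t : State N, Tame c K t → t.nat = s.nat → t.real = s.real →
      t.elem = Function.update s.elem a (s.elem v) → Q t) :
    Runs f M (Tame c K) (.copyElem i e) s Q := by
  have ht : Tame c K { s with elem := Function.update s.elem (i.eval s) (s.elem (e.eval s)) } := by
    refine ⟨fun j hj => ?_, hs.real, hs.nat, hs.lt⟩
    rw [ha]
    exact (Function.update_of_ne (by omega) _ _).trans (hs.elem j hj)
  exact ⟨_, .copyElem hs ht, h _ ht rfl rfl (by rw [ha, hv])⟩

theorem clearElem {i : NatExpr} (hs : Tame c K s) (a : ℕ) (ha : i.eval s = a)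
    (h : ∀ t : State N, Tame c K t → t.nat = s.nat → t.real = s.real →
      t.elem = Function.update s.elem a none → Q t) :
    Runs f M (Tame c K) (.clearElem i) s Q := by
  have ht : Tame c K { s with elem := Function.update s.elem (i.eval s) none } := by
    refine ⟨fun j hj => ?_, hs.real, hs.nat, hs.lt⟩
    simp only [Function.update_apply]
    split_ifs
    · rfl
    · exact hs.elem j hj
  exact ⟨_, .clearElem hs ht, h _ ht rfl rfl (by rw [ha])⟩

end Runs

theorem State.mem_pick {s : State N} {m : ℕ} {x : N} :
    x ∈ s.pick m ↔ ∃ j, m.testBit j = true ∧ s.elem j = some x := by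
  classical simp [State.pick]

theorem State.mem_pick_bitCode {s : State N} {J : Finset ℕ} {x : N} :
    x ∈ s.pick (bitCode J) ↔ ∃ j ∈ J, s.elem j = some x := by
  simp only [State.mem_pick, testBit_bitCode]

theorem State.pick_congr {s t : State N} (h : t.elem = s.elem) (m : ℕ) : t.pick m = s.pick m := by
  ext; simp [State.mem_pick, h]

end Logic

/-! ### The program of the exchange algorithm -/

section Programs

/-- The content of the cell `a` for natural numbers. -/
def NatExpr.var (a : ℕ) : NatExpr := .load (.const a)

/-- The content of the cell `a` for reals. -/
def RealExpr.var (a : ℕ) : RealExpr := .load (.const a)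

/-- Digit `j` of `m` is one, where `p = 2 ^ j`. -/
def Test.bit (m p : NatExpr) : Test := .natLe (.const 1) (.mod (.div m p) (.const 2))

/-- `a < b` for reals. -/
def Test.realLt (a b : RealExpr) : Test := .not (.realLe b a)

/-- Assignment to the cell `a` for natural numbers. -/
def Cmd.assign (a : ℕ) (e : NatExpr) : Cmd := .setNat (.const a) e

/-- Assignment to the cell `a` for reals. -/
def Cmd.assignReal (a : ℕ) (e : RealExpr) : Cmd := .setReal (.const a) e

/-- Cell `2` holds `j` and cell `3` holds `2 ^ j`: set `j` to a constant. -/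
def Cmd.startAt (j : ℕ) : Cmd := .seq (.assign 2 (.const j)) (.assign 3 (.const (2 ^ j)))

/-- Increase the counter `j`. -/
def Cmd.advance : Cmd :=
  .seq (.assign 2 (.add (.var 2) (.const 1))) (.assign 3 (.add (.var 3) (.var 3)))

/-- The number of cells for elements. -/
def cellCount (n : ℕ) : NatExpr := .mul (.const (22 * n)) (.add (.var 0) (.const 1))

/-- The counter `j` is below the number of cells. -/
def inRange (n : ℕ) : Test := .natLe (.add (.var 2) (.const 1)) (cellCount n)

/-- The code of the solution of class `i`. -/
def solCode (i : ℕ) : NatExpr := .var (16 + i)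

/-- Find the lightest element that the arriving element can replace in class `i`: its weight goes
to the real cell `2` and its code to cell `4`. -/
def findVictim (n i : ℕ) : Cmd :=
  .while (inRange n) <|
    .seq (.ite (.and (.bit (solCode i) (.var 3))
        (.and (.indep (.add (.sub (solCode i) (.var 3)) (.const 1)))
          (.realLe (.load (.var 2)) (.var 2))))
      (.seq (.assignReal 2 (.load (.var 2))) (.assign 4 (.var 3))) .skip)
    .advance

/-- Make class `i` the chosen one if it can accept the arriving element with a larger gain than
that of the class chosen so far. -/
def examine (n i : ℕ) : Cmd :=
  .seq (.assignReal 1 (.sub (.value (.add (solCode i) (.const 1))) (.value (solCode i)))) <|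
  .seq (.assign 4 (.const 0)) <|
  .seq (.assignReal 2 (.const 0)) <|
  .seq (.ite (.indep (.add (solCode i) (.const 1))) .skip
    -- The search starts from the gain itself as victim weight. If it finds no candidate, the
    -- acceptance test below fails for every positive gain.
    (.seq (.assignReal 2 (.var 1)) (.seq (.startAt 8) (findVictim n i)))) <|
  .ite (.and (.realLt (.var 3) (.var 1)) (.realLe (.add (.var 2) (.var 2)) (.var 1)))
    (.seq (.assignReal 3 (.var 1)) <| .seq (.assignReal 4 (.var 2)) <|
      -- Cell `5` holds the address of the mask of the chosen class; the value `0` means that no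
      -- class is chosen.
      .seq (.assign 5 (.const (16 + i))) (.assign 6 (.var 4)))
    .skip

/-- Examine the first `i` classes. -/
def examineAll (n : ℕ) : ℕ → Cmd
  | 0 => .skip
  | i + 1 => .seq (examineAll n i) (examine n i)

/-- Cell `j` does not belong to the solutions of the first `i` classes. -/
def unused : ℕ → Test
  | 0 => .natLe (.const 0) (.const 0)
  | i + 1 => .and (unused i) (.not (.bit (solCode i) (.var 3)))

/-- Cell `j` can be overwritten. -/
def replaceable (n : ℕ) : Test :=
  .and (.realLe (.mul (.mul (.const (10 * n : ℕ)) (.ofNat (.add (.var 0) (.const 1))))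
    (.load (.var 2))) (.var 0)) (unused n)

/-- Store the arriving element, and update the solution of the chosen class. -/
def commit (n : ℕ) : Cmd :=
  .seq (.assignReal 0 (.add (.var 0) (.sub (.var 3) (.var 4)))) <|
  -- The victim leaves the mask before the scan, so its own cell may be reused if it is light.
  .seq (.setNat (.var 5) (.sub (.load (.var 5)) (.var 6))) <|
  .seq (.startAt 8) <|
  .seq (.while (.not (replaceable n)) .advance) <|
  .seq (.copyElem (.var 2) (.const 0)) <|
  .seq (.setReal (.var 2) (.var 3)) (.setNat (.var 5) (.add (.load (.var 5)) (.var 3)))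

/-- The program that processes an arriving element. -/
def processElement (n : ℕ) : Cmd :=
  .seq (.assign 5 (.const 0)) <| .seq (.assignReal 3 (.const 0)) <|
  .seq (examineAll n n) <| .ite (.natLe (.const 1) (.var 5)) (commit n) .skip

/-- Search all sets of stored elements for the best independent one. -/
def searchBest : Cmd :=
  .while (.natLe (.add (.var 7) (.const 1)) (.var 3)) <|
    .seq (.ite (.and (.indep (.var 7)) (.realLe (.var 5) (.value (.var 7))))
      (.seq (.assignReal 5 (.value (.var 7))) (.assign 4 (.var 7))) .skip)
    (.assign 7 (.add (.var 7) (.const 1)))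

/-- Remove the elements outside of the best set. -/
def clearRest (n : ℕ) : Cmd :=
  .while (inRange n) (.seq (.ite (.bit (.var 4) (.var 3)) .skip (.clearElem (.var 2))) .advance)

/-- The program run after the end of the stream. -/
def outputBest (n : ℕ) : Cmd :=
  -- This loop only computes `2 ^ K`, with `K` the number of element cells, as the bound for the
  -- search over masks.
  .seq (.startAt 0) <| .seq (.while (inRange n) .advance) <|
  .seq (.assign 7 (.const 0)) <| .seq (.assign 4 (.const 0)) <|
  .seq (.assignReal 5 (.value (.const 0))) <| .seq searchBest <|
  .seq (.startAt 0) (clearRest n)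

/-- The exchange algorithm with `n` classes. -/
def exchangeAlgorithm (n : ℕ) : Algorithm := ⟨.skip, processElement n, outputBest n⟩

end Programs

/-! ### Correctness of the examination of the classes -/

section Verification

variable {N : Type*} [Fintype N] [DecidableEq N] {f : Finset N → ℝ} {M : Matroid N}
  {n k c K : ℕ} {H : Finset N} {S : ℕ → Finset N} {ω : N → ℝ} {pos : N → ℕ} {u : N}

omit [Fintype N] [DecidableEq N] in
@[simp] theorem NatExpr.eval_const (s : State N) (a : ℕ) : (NatExpr.const a).eval s = a := rfl

omit [Fintype N] [DecidableEq N] in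
@[simp] theorem NatExpr.eval_var (s : State N) (a : ℕ) : (NatExpr.var a).eval s = s.nat a := rfl

omit [DecidableEq N] in
@[simp] theorem RealExpr.eval_var (s : State N) (a : ℕ) : (RealExpr.var a).eval f s = s.real a :=
  rfl

omit [DecidableEq N] in
theorem Test.eval_bit {m p : NatExpr} {s : State N} {j : ℕ} (hp : p.eval s = 2 ^ j) :
    (Test.bit m p).eval f M s ↔ (m.eval s).testBit j = true := by
  simp only [Test.bit, Test.eval, NatExpr.eval, hp, Nat.testBit_eq_decide_div_mod_eq,
    decide_eq_true_eq]
  omega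

omit [DecidableEq N] in
theorem Test.eval_inRange {s : State N} (h0 : s.nat 0 = k) :
    (inRange n).eval f M s ↔ s.nat 2 < 22 * n * (k + 1) := by
  simp [inRange, Test.eval, NatExpr.eval, cellCount, h0]

omit [DecidableEq N] in
theorem runs_startAt {s : State N} {Q : State N → Prop} (hs : Tame c K s) (j : ℕ) (hc : 4 ≤ c)
    (hj : j ≤ K) (h : ∀ t : State N, Tame c K t → t.elem = s.elem → t.real = s.real →
      t.nat 2 = j → t.nat 3 = 2 ^ j → (∀ a, a ≠ 2 → a ≠ 3 → t.nat a = s.nat a) → Q t) :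
    Runs f M (Tame c K) (.startAt j) s Q := by
  have hlt : 2 ^ j < 2 ^ (K + 1) := Nat.pow_lt_pow_right (by norm_num) (by omega)
  refine .seq (.setNat hs 2 j rfl rfl (by omega) (Nat.lt_two_pow_self.trans hlt) ?_)
  intro t ht he hr hn
  refine .setNat ht 3 (2 ^ j) rfl rfl (by omega) hlt ?_
  intro r hr' he' hrr hn'
  refine h r hr' (he'.trans he) (hrr.trans hr) ?_ ?_ fun a h2 h3 => ?_ <;> simp_all

omit [DecidableEq N] in
theorem runs_advance {s : State N} {Q : State N → Prop} {j : ℕ} (hs : Tame c K s) (hc : 4 ≤ c)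
    (hj : s.nat 2 = j) (hp : s.nat 3 = 2 ^ j) (hjK : j < K)
    (h : ∀ t : State N, Tame c K t → t.elem = s.elem → t.real = s.real →
      t.nat 2 = j + 1 → t.nat 3 = 2 ^ (j + 1) → (∀ a, a ≠ 2 → a ≠ 3 → t.nat a = s.nat a) → Q t) :
    Runs f M (Tame c K) .advance s Q := by
  have hlt : 2 ^ (j + 1) < 2 ^ (K + 1) := Nat.pow_lt_pow_right (by norm_num) (by omega)
  refine .seq (.setNat hs 2 (j + 1) rfl (by simp [NatExpr.eval, hj]) (by omega)
    (Nat.lt_two_pow_self.trans hlt) ?_)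
  intro t ht he hr hn
  refine .setNat ht 3 (2 ^ (j + 1)) rfl (by simp [NatExpr.eval, hn, hp]; ring) (by omega) hlt ?_
  intro r hr' he' hrr hn'
  refine h r hr' (he'.trans he) (hrr.trans hr) ?_ ?_ fun a h2 h3 => ?_ <;> simp_all

omit [DecidableEq N] in
theorem State.pick_image {s : State N} {T : Finset N} (h : ∀ x ∈ T, s.elem (pos x) = some x) :
    s.pick (bitCode (T.image pos)) = T := by
  ext x
  rw [State.mem_pick_bitCode]
  constructor
  · rintro ⟨j, hj, hx⟩
    obtain ⟨y, hy, rfl⟩ := mem_image.1 hj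
    rw [h y hy] at hx
    cases hx
    exact hy
  · exact fun hx => ⟨pos x, mem_image_of_mem _ hx, h x hx⟩

/-- Stored elements occupy cells from `8` on, so adding one to a mask sets the free bit `0`, the
cell of the arriving element. -/
theorem State.pick_image_add_one {s : State N} {T : Finset N}
    (h : ∀ x ∈ T, s.elem (pos x) = some x) (hpos : ∀ x ∈ T, 8 ≤ pos x) (hu : s.elem 0 = some u) :
    s.pick (bitCode (T.image pos) + 1) = insert u T := by
  have h0 : 0 ∉ T.image pos := fun h0 => by
    obtain ⟨y, hy, hy0⟩ := mem_image.1 h0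
    have := hpos y hy
    omega
  have hcode : bitCode (T.image pos) + 1 = bitCode (insert 0 (T.image pos)) :=
    (bitCode_insert h0).symm
  ext x
  rw [hcode, State.mem_pick_bitCode, mem_insert]
  have h1 := State.mem_pick_bitCode (s := s) (J := T.image pos) (x := x)
  rw [State.pick_image h] at h1
  rw [h1]
  constructor
  · rintro ⟨j, hj, hx⟩
    rcases mem_insert.1 hj with rfl | hj
    · rw [hu] at hx
      cases hx
      exact .inl rfl
    · exact .inr ⟨j, hj, hx⟩
  · rintro (rfl | ⟨j, hj, hx⟩)
    · exact ⟨0, by simp, hu⟩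
    · exact ⟨j, by simp [hj], hx⟩

/-- The state stores the elements `x ∈ H` with weights `ω x` in the cells `pos x`, and the
solutions `S i` of the classes `i < n`. -/
structure Stored (n k : ℕ) (H : Finset N) (S : ℕ → Finset N) (ω : N → ℝ) (pos : N → ℕ)
    (s : State N) : Prop where
  rank : s.nat 0 = k
  elem : ∀ x ∈ H, s.elem (pos x) = some x
  pos_ge : ∀ x ∈ H, 8 ≤ pos x
  pos_lt : ∀ x ∈ H, pos x < 22 * n * (k + 1)
  weight : ∀ x ∈ H, s.real (pos x) = ω x
  empty : ∀ j, 8 ≤ j → s.real j ≠ 0 → ∃ x ∈ H, pos x = j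
  code : ∀ i < n, s.nat (16 + i) = bitCode ((S i).image pos)
  total : s.real 0 = totalWeight n S ω

/-- The cells that hold the data of the algorithm between arrivals are the same. -/
structure SameData (s t : State N) : Prop where
  elem : t.elem = s.elem
  rank : t.nat 0 = s.nat 0
  code : ∀ i, t.nat (16 + i) = s.nat (16 + i)
  total : t.real 0 = s.real 0
  real : ∀ j, 8 ≤ j → t.real j = s.real j

omit [Fintype N] [DecidableEq N] in
theorem Stored.sameData {s t : State N} (h : Stored n k H S ω pos s) (hst : SameData s t) :
    Stored n k H S ω pos t := by
  refine ⟨hst.rank.trans h.rank, fun x hx => ?_, h.pos_ge, h.pos_lt, fun x hx => ?_,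
    fun j hj hne => ?_, fun i hi => (hst.code i).trans (h.code i hi), hst.total.trans h.total⟩
  · rw [hst.elem]
    exact h.elem x hx
  · rw [hst.real _ (h.pos_ge x hx)]
    exact h.weight x hx
  · rw [hst.real j hj] at hne
    exact h.empty j hj hne

omit [Fintype N] [DecidableEq N] in
theorem Stored.injOn {s : State N} (h : Stored n k H S ω pos s) : Set.InjOn pos H := by
  intro x hx y hy hxy
  have h1 := h.elem x hx
  rw [hxy, h.elem y hy] at h1
  exact (Option.some_injective _ h1).symm

/-- The element `x` of the solution `T` can be replaced by the arriving element `u`. -/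
def Replaces (M : Matroid N) (T : Finset N) (u x : N) : Prop :=
  M.Indep (insert u (T.erase x) : Finset N)

theorem runs_findVictim {s : State N} (hs : Tame (16 + n) (22 * n * (k + 1)) s)
    (hst : Stored n k H S ω pos s) (hu : s.elem 0 = some u) {i : ℕ} (hi : i < n) (hSH : S i ⊆ H)
    (hj : s.nat 2 = 8) (hp : s.nat 3 = 2 ^ 8) :
    Runs f M (Tame (16 + n) (22 * n * (k + 1))) (findVictim n i) s fun t =>
      Tame (16 + n) (22 * n * (k + 1)) t ∧ t.elem = s.elem ∧
      (∀ a, a ≠ 2 → a ≠ 3 → a ≠ 4 → t.nat a = s.nat a) ∧ (∀ a, a ≠ 2 → t.real a = s.real a) ∧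
      (∀ x ∈ S i, Replaces M (S i) u x → t.real 2 ≤ ω x) ∧
      (t.real 2 = s.real 2 ∨ ∃ v ∈ S i, Replaces M (S i) u v ∧ t.nat 4 = 2 ^ pos v ∧
        t.real 2 = ω v) := by
  set K := 22 * n * (k + 1) with hK
  have hK8 : 8 ≤ K := by nlinarith
  -- Real cell `2` is a lower bound for the candidates in cells already scanned, and it is either
  -- untouched or attained by the candidate coded in cell `4`.
  refine Runs.loop (fun t => Tame (16 + n) K t ∧ t.elem = s.elem ∧
      (∀ a, a ≠ 2 → a ≠ 3 → a ≠ 4 → t.nat a = s.nat a) ∧ (∀ a, a ≠ 2 → t.real a = s.real a) ∧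
      8 ≤ t.nat 2 ∧ t.nat 3 = 2 ^ t.nat 2 ∧
      (∀ x ∈ S i, pos x < t.nat 2 → Replaces M (S i) u x → t.real 2 ≤ ω x) ∧
      (t.real 2 = s.real 2 ∨ ∃ v ∈ S i, Replaces M (S i) u v ∧ t.nat 4 = 2 ^ pos v ∧
        t.real 2 = ω v)) (fun t => K - t.nat 2) (fun t h => h.1) ?_ ?_ ?_
  · rintro t ⟨ht, he, hn, hr, -, -, hmin, hv⟩ hb
    rw [Test.eval_inRange ((hn 0 (by simp) (by simp) (by simp)).trans hst.rank)] at hb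
    exact ⟨ht, he, hn, hr, fun x hx => hmin x hx
      ((hst.pos_lt x (hSH hx)).trans_le (not_lt.1 hb)), hv⟩
  · rintro t ⟨ht, he, hn, hr, h8, hp, hmin, hv⟩ hb
    rw [Test.eval_inRange ((hn 0 (by simp) (by simp) (by simp)).trans hst.rank), ← hK] at hb
    have hcode : t.nat (16 + i) = bitCode ((S i).image pos) :=
      (hn _ (by omega) (by omega) (by omega)).trans (hst.code i hi)
    have helem : ∀ x ∈ S i, t.elem (pos x) = some x := fun x hx => by
      rw [he]; exact hst.elem x (hSH hx)
    have hbit : (Test.bit (solCode i) (.var 3)).eval f M t ↔ ∃ x ∈ S i, pos x = t.nat 2 := by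
      rw [Test.eval_bit (j := t.nat 2) (by simpa using hp), solCode, NatExpr.eval_var, hcode,
        testBit_bitCode, mem_image]
    have hindep : ∀ x ∈ S i, pos x = t.nat 2 →
        ((Test.indep (.add (.sub (solCode i) (.var 3)) (.const 1))).eval f M t ↔
          Replaces M (S i) u x) := by
      intro x hx hxj
      have h1 : (NatExpr.add (.sub (solCode i) (.var 3)) (.const 1)).eval t =
          bitCode (((S i).erase x).image pos) + 1 := by
        rw [← sdiff_singleton_eq_erase,
          image_sdiff_of_injOn (hst.injOn.mono (by exact_mod_cast hSH)) (by simpa using hx),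
          image_singleton, sdiff_singleton_eq_erase, bitCode_erase (mem_image_of_mem _ hx), ← hcode, hxj, ← hp]
        rfl
      rw [Test.eval, h1, State.pick_image_add_one (u := u)
        (fun y hy => helem y (mem_of_mem_erase hy))
        (fun y hy => hst.pos_ge y (hSH (mem_of_mem_erase hy))) (by rw [he, hu])]
      rfl
    have hwt : ∀ x ∈ S i, pos x = t.nat 2 → t.real (t.nat 2) = ω x := fun x hx hxj => by
      rw [hr _ (by omega), ← hxj]
      exact hst.weight x (hSH hx)
    refine .seq_of (Q' := fun r => Tame (16 + n) K r ∧ r.elem = s.elem ∧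
      (∀ a, a ≠ 4 → r.nat a = t.nat a) ∧ (∀ a, a ≠ 2 → r.real a = s.real a) ∧
      (∀ x ∈ S i, pos x < t.nat 2 + 1 → Replaces M (S i) u x → r.real 2 ≤ ω x) ∧
      (r.real 2 = s.real 2 ∨ ∃ v ∈ S i, Replaces M (S i) u v ∧ r.nat 4 = 2 ^ pos v ∧
        r.real 2 = ω v)) (.ite ?_ ?_) ?_
    · rintro ⟨hb1, hb2, hb3⟩
      obtain ⟨x, hx, hxj⟩ := hbit.1 hb1
      have hx' := (hindep x hx hxj).1 hb2
      have hle : ω x ≤ t.real 2 := by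
        rw [← hwt x hx hxj]
        exact hb3
      refine .seq (.setReal ht 2 (ω x) rfl (hwt x hx hxj) (by omega) ?_)
      intro r hr1 hr2 hr3 hr4
      refine .setNat hr1 4 (2 ^ pos x) rfl (by simp [hr3, hp, hxj]) (by omega)
        (Nat.pow_lt_pow_right (by norm_num) (by omega)) ?_
      intro q hq1 hq2 hq3 hq4
      have hq5 : q.real 2 = ω x := by rw [hq3, hr4, Function.update_self]
      refine ⟨hq1, by rw [hq2, hr2, he], fun a ha => ?_, fun a ha => ?_, fun y hy hyj hyr => ?_,
        .inr ⟨x, hx, hx', by simp [hq4], hq5⟩⟩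
      · rw [hq4, Function.update_of_ne ha, hr3]
      · rw [hq3, hr4, Function.update_of_ne ha]
        exact hr a ha
      · rw [hq5]
        rcases Nat.lt_succ_iff_lt_or_eq.1 hyj with h | h
        · exact hle.trans (hmin y hy h hyr)
        · rw [hst.injOn (hSH hx) (hSH hy) (hxj.trans h.symm)]
    · intro hb1
      refine .skip ht ⟨ht, he, fun _ _ => rfl, hr, fun y hy hyj hyr => ?_, hv⟩
      rcases Nat.lt_succ_iff_lt_or_eq.1 hyj with h | h
      · exact hmin y hy h hyr
      · rw [← hwt y hy h]
        by_contra hlt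
        exact hb1 ⟨hbit.2 ⟨y, hy, h⟩, (hindep y hy h).2 hyr, (not_le.1 hlt).le⟩
    · rintro r ⟨hr1, hr2, hr3, hr4, hr5, hr6⟩
      refine runs_advance hr1 (by omega) (hr3 2 (by simp)) ((hr3 3 (by simp)).trans hp) hb ?_
      intro q hq1 hq2 hq3 hq4 hq5 hq6
      refine ⟨⟨hq1, hq2.trans hr2, fun a h2 h3 h4 => ?_, fun a ha => ?_, by omega,
        by rw [hq5, hq4], ?_, ?_⟩, by omega⟩
      · rw [hq6 a h2 h3, hr3 a h4]
        exact hn a h2 h3 h4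
      · rw [hq3]
        exact hr4 a ha
      · rw [hq4, hq3]
        exact hr5
      · rw [hq3, hq6 4 (by simp) (by simp)]
        exact hr6
  · refine ⟨hs, rfl, fun _ _ _ _ => rfl, fun _ _ => rfl, by omega, by rw [hp, hj], ?_, .inl rfl⟩
    intro x hx hlt
    have := hst.pos_ge x (hSH hx)
    omega

/-- The outcome of the examination of the first `i` classes. -/
structure Selection (f : Finset N → ℝ) (M : Matroid N) (S : ℕ → Finset N) (ω : N → ℝ)
    (pos : N → ℕ) (u : N) (i : ℕ) (s : State N) : Prop where
  nonneg : 0 ≤ s.real 3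
  passed : ∀ j < i, ExchangeInv.Passed f M (S j) ω u (s.real 3)
  chosen : s.nat 5 = 0 ∧ s.real 3 = 0 ∨ ∃ j < i, ∃ V : Finset N, s.nat 5 = 16 + j ∧ 0 < s.real 3 ∧
    s.real 3 = f (insert u (S j)) - f (S j) ∧ IsSwap M (S j) ω u V ∧ s.real 4 = ∑ v ∈ V, ω v ∧
    2 * ∑ v ∈ V, ω v ≤ s.real 3 ∧ s.nat 6 = bitCode (V.image pos)

theorem runs_examine {s : State N} (hE : M.E = Set.univ)
    (hs : Tame (16 + n) (22 * n * (k + 1)) s)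
    (hst : Stored n k H S ω pos s) (hu : s.elem 0 = some u) {i : ℕ} (hi : i < n) (hSH : S i ⊆ H)
    (hind : M.Indep (S i : Set N)) (huS : u ∉ S i) (hsel : Selection f M S ω pos u i s) :
    Runs f M (Tame (16 + n) (22 * n * (k + 1))) (examine n i) s fun t =>
      Tame (16 + n) (22 * n * (k + 1)) t ∧ SameData s t ∧ Selection f M S ω pos u (i + 1) t := by
  have hK8 : 8 ≤ 22 * n * (k + 1) := by nlinarith
  set d := f (insert u (S i)) - f (S i) with hd
  have helem : ∀ x ∈ S i, s.elem (pos x) = some x := fun x hx => hst.elem x (hSH hx)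
  have hpick : ∀ t : State N, t.elem = s.elem → t.nat (16 + i) = s.nat (16 + i) →
      t.pick ((NatExpr.add (solCode i) (.const 1)).eval t) = insert u (S i) := by
    intro t he hn
    rw [State.pick_congr he]
    have : (NatExpr.add (solCode i) (.const 1)).eval t = bitCode ((S i).image pos) + 1 := by
      rw [← hst.code i hi, ← hn]
      rfl
    rw [this]
    exact State.pick_image_add_one helem (fun x hx => hst.pos_ge x (hSH hx)) hu
  refine .seq (.setReal hs 1 d rfl ?_ (by omega) ?_)
  · have : s.pick ((solCode i).eval s) = S i := by
      rw [solCode, NatExpr.eval_var, hst.code i hi]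
      exact State.pick_image helem
    rw [RealExpr.eval, RealExpr.eval, RealExpr.eval, hpick s rfl rfl, this]
  intro t1 ht1 he1 hn1 hr1
  refine .seq (.setNat ht1 4 0 rfl rfl (by omega) (by positivity) ?_)
  intro t2 ht2 he2 hr2 hn2
  refine .seq (.setReal ht2 2 0 rfl (by simp [RealExpr.eval]) (by omega) ?_)
  intro t3 ht3 he3 hn3 hr3
  have he : t3.elem = s.elem := by rw [he3, he2, he1]
  have hnat : ∀ a, a ≠ 4 → t3.nat a = s.nat a := fun a ha => by
    rw [hn3, hn2, Function.update_of_ne ha, hn1]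
  have hreal : ∀ a, a ≠ 1 → a ≠ 2 → t3.real a = s.real a := fun a h1 h2 => by
    rw [hr3, Function.update_of_ne h2, hr2, hr1, Function.update_of_ne h1]
  have hreal1 : t3.real 1 = d := by simp [hr3, hr2, hr1]
  have hsame3 : SameData s t3 := ⟨he, hnat 0 (by simp), fun i => hnat _ (by omega),
    hreal 0 (by simp) (by simp), fun j hj => hreal j (by omega) (by omega)⟩
  refine .seq_of (Q' := fun r => Tame (16 + n) (22 * n * (k + 1)) r ∧ r.elem = s.elem ∧
      (∀ a, a ≠ 2 → a ≠ 3 → a ≠ 4 → r.nat a = s.nat a) ∧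
      (∀ a, a ≠ 1 → a ≠ 2 → r.real a = s.real a) ∧ r.real 1 = d ∧
      -- The acceptance test decides between a valid swap and the certificate that no swap is
      -- acceptable; the latter does not depend on the threshold, so `0` serves.
      (0 < d → if 2 * r.real 2 ≤ d then ∃ V, IsSwap M (S i) ω u V ∧ r.real 2 = ∑ v ∈ V, ω v ∧
        r.nat 4 = bitCode (V.image pos) else ExchangeInv.Passed f M (S i) ω u 0))
      (.ite ?_ ?_) ?_
  · intro hb
    rw [Test.eval, hpick t3 he (hnat _ (by omega))] at hb
    refine .skip ht3 ⟨ht3, he, fun a _ _ h => hnat a h, hreal, hreal1, fun hpos => ?_⟩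
    have h2 : t3.real 2 = 0 := by simp [hr3]
    rw [if_pos (by rw [h2]; linarith)]
    exact ⟨∅, IsSwap.empty hb, by simp [h2], by simp [hn3, hn2, bitCode]⟩
  · intro hb
    rw [Test.eval, hpick t3 he (hnat _ (by omega))] at hb
    refine .seq (.setReal ht3 2 d rfl hreal1 (by omega) ?_)
    intro t4 ht4 he4 hn4 hr4
    refine .seq (runs_startAt ht4 8 (by omega) hK8 ?_)
    intro t5 ht5 he5 hr5 hj5 hp5 hn5
    have hsame5 : SameData t3 t5 := ⟨by rw [he5, he4], by rw [hn5 0 (by simp) (by simp), hn4],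
      fun i => by rw [hn5 _ (by omega) (by omega), hn4], by simp [hr5, hr4],
      fun j hj => by rw [hr5, hr4, Function.update_of_ne (by omega)]⟩
    refine (runs_findVictim ht5 ((hst.sameData hsame3).sameData hsame5) (u := u)
      (by rw [he5, he4, he, hu]) hi hSH hj5 hp5).mono ?_
    rintro t6 ⟨ht6, he6, hn6, hr6, hmin, hv⟩
    refine ⟨ht6, by rw [he6, he5, he4, he], fun a h2 h3 h4 => ?_, fun a h1 h2 => ?_, ?_,
      fun hpos => ?_⟩
    · rw [hn6 a h2 h3 h4, hn5 a h2 h3, hn4, hnat a h4]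
    · rw [hr6 a h2, hr5, hr4, Function.update_of_ne h2, hreal a h1 h2]
    · rw [hr6 1 (by simp), hr5, hr4, Function.update_of_ne (by simp), hreal1]
    · have h52 : t5.real 2 = d := by simp [hr5, hr4]
      split_ifs with hle
      · rcases hv with hv | ⟨v, hvS, hvr, hv4, hv2⟩
        -- No victim was recorded: the cell still holds `d`, and `2 * d ≤ d` contradicts `0 < d`.
        · rw [h52] at hv
          linarith
        · refine ⟨{v}, IsSwap.singleton hE huS hind hb hvS hvr fun x hx hxr => ?_, by simp [hv2],
            by simp [hv4, bitCode]⟩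
          rw [← hv2]
          exact hmin x hx hxr
      · exact .inr ⟨hb, fun x hx hxr => by linarith [hmin x hx hxr]⟩
  rintro t7 ⟨ht7, he7, hn7, hr7, hd7, hvic⟩
  -- Raising the best gain keeps the certificates of the earlier classes.
  have hpassed : ∀ {e : ℝ}, s.real 3 ≤ e → ∀ j < i, ExchangeInv.Passed f M (S j) ω u e :=
    fun he j hj => (hsel.passed j hj).imp_left fun h => h.trans he
  have hR3 : t7.real 3 = s.real 3 := hr7 3 (by simp) (by simp)
  refine .ite ?_ ?_
  · intro hb
    simp only [Test.eval, Test.realLt, RealExpr.eval_var, RealExpr.eval, hd7, hR3, not_le] at hb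
    obtain ⟨hb1, hb2⟩ := hb
    have hpos : 0 < d := hsel.nonneg.trans_lt hb1
    have hv := hvic hpos
    rw [if_pos (by linarith)] at hv
    obtain ⟨V, hV1, hV2, hV3⟩ := hv
    refine .seq (.setReal ht7 3 d rfl hd7 (by omega) ?_)
    intro t8 ht8 he8 hn8 hr8
    refine .seq (.setReal ht8 4 (t7.real 2) rfl (by simp [hr8]) (by omega) ?_)
    intro t9 ht9 he9 hn9 hr9
    refine .seq (.setNat ht9 5 (16 + i) rfl rfl (by omega) ?_ ?_)
    · have : 16 + i < 22 * n * (k + 1) := by nlinarith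
      exact (Nat.lt_two_pow_self.trans (Nat.pow_lt_pow_right (by norm_num) (by omega)))
    intro t10 ht10 he10 hr10 hn10
    refine .setNat ht10 6 (t7.nat 4) rfl (by simp [hn10, hn9, hn8]) (by omega) (ht7.lt 4) ?_
    intro t11 ht11 he11 hr11 hn11
    have hnat' : ∀ a, a ≠ 5 → a ≠ 6 → t11.nat a = t7.nat a := fun a h5 h6 => by
      rw [hn11, Function.update_of_ne h6, hn10, Function.update_of_ne h5, hn9, hn8]
    have hreal' : ∀ a, a ≠ 3 → a ≠ 4 → t11.real a = t7.real a := fun a h3 h4 => by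
      rw [hr11, hr10, hr9, Function.update_of_ne h4, hr8, Function.update_of_ne h3]
    have h3 : t11.real 3 = d := by simp [hr11, hr10, hr9, hr8]
    have h4 : t11.real 4 = t7.real 2 := by simp [hr11, hr10, hr9]
    refine ⟨ht11, ⟨by rw [he11, he10, he9, he8, he7], ?_, fun j => ?_, ?_, fun j hj => ?_⟩,
      ⟨by rw [h3]; exact hpos.le, ?_, .inr ⟨i, by omega, V, by simp [hn11, hn10], by rwa [h3],
        by rw [h3], hV1, by rw [h4, hV2], by rw [h3, ← hV2]; linarith, by simp [hn11, hV3]⟩⟩⟩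
    · rw [hnat' 0 (by simp) (by simp), hn7 0 (by simp) (by simp) (by simp)]
    · rw [hnat' _ (by omega) (by omega), hn7 _ (by omega) (by omega) (by omega)]
    · rw [hreal' 0 (by simp) (by simp), hr7 0 (by simp) (by simp)]
    · rw [hreal' j (by omega) (by omega), hr7 j (by omega) (by omega)]
    · intro j hj
      rw [h3]
      rcases Nat.lt_succ_iff_lt_or_eq.1 hj with hj | rfl
      · exact hpassed hb1.le j hj
      · exact .inl le_rfl
  · intro hb
    simp only [Test.eval, Test.realLt, RealExpr.eval_var, RealExpr.eval, hd7, hR3, not_le,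
      not_and] at hb
    refine .skip ht7 ⟨ht7, ⟨he7, hn7 0 (by simp) (by simp) (by simp),
      fun j => hn7 _ (by omega) (by omega) (by omega), hr7 0 (by simp) (by simp),
      fun j hj => hr7 j (by omega) (by omega)⟩, ⟨by rw [hR3]; exact hsel.nonneg, ?_, ?_⟩⟩
    · intro j hj
      rw [hR3]
      rcases Nat.lt_succ_iff_lt_or_eq.1 hj with hj | rfl
      · exact hpassed le_rfl j hj
      -- A class that is not chosen has either no larger gain than the current best or no acceptable
      -- swap.
      · by_cases hlt : s.real 3 < d
        · have hv := hvic (hsel.nonneg.trans_lt hlt)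
          rw [if_neg (by linarith [hb hlt])] at hv
          exact hv.imp_left fun h => h.trans hsel.nonneg
        · exact .inl (not_lt.1 hlt)
    · rw [hR3, hr7 4 (by simp) (by simp), hn7 5 (by simp) (by simp) (by simp),
        hn7 6 (by simp) (by simp) (by simp)]
      exact hsel.chosen.imp_right fun ⟨j, hj, h⟩ => ⟨j, by omega, h⟩

omit [Fintype N] [DecidableEq N] in
theorem SameData.trans {s t r : State N} (h : SameData s t) (h' : SameData t r) : SameData s r :=
  ⟨h'.elem.trans h.elem, h'.rank.trans h.rank, fun i => (h'.code i).trans (h.code i),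
    h'.total.trans h.total, fun j hj => (h'.real j hj).trans (h.real j hj)⟩

theorem runs_examineAll {s : State N} (hE : M.E = Set.univ)
    (hs : Tame (16 + n) (22 * n * (k + 1)) s)
    (hst : Stored n k H S ω pos s) (hu : s.elem 0 = some u) (hSH : ∀ i, S i ⊆ H)
    (hind : ∀ i, M.Indep (S i : Set N)) (huS : ∀ i, u ∉ S i) (h5 : s.nat 5 = 0)
    (h3 : s.real 3 = 0) {i : ℕ} (hi : i ≤ n) :
    Runs f M (Tame (16 + n) (22 * n * (k + 1))) (examineAll n i) s fun t =>
      Tame (16 + n) (22 * n * (k + 1)) t ∧ SameData s t ∧ Selection f M S ω pos u i t := by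
  induction i with
  | zero => exact .skip hs ⟨hs, ⟨rfl, rfl, fun _ => rfl, rfl, fun _ _ => rfl⟩,
      ⟨h3.ge, by simp, .inl ⟨h5, h3⟩⟩⟩
  | succ i ih =>
    refine .seq_of (ih (by omega)) ?_
    rintro t ⟨ht, hsame, hsel⟩
    exact (runs_examine hE ht (hst.sameData hsame) (by rw [hsame.elem, hu]) hi (hSH i) (hind i)
      (huS i) hsel).mono fun r ⟨hr, hr', hr''⟩ => ⟨hr, hsame.trans hr', hr''⟩

end Verification

/-! ### Overwriting a cell -/

section Commit

variable {N : Type*} [Fintype N] [DecidableEq N] {f : Finset N → ℝ} {M : Matroid N}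
  {n k c K : ℕ} {P H : Finset N} {S A : ℕ → Finset N} {ω : N → ℝ} {pos : N → ℕ} {u : N}

omit [DecidableEq N] in
theorem eval_unused {s : State N} (hp : s.nat 3 = 2 ^ s.nat 2) {J : ℕ → Finset ℕ} (i : ℕ)
    (hJ : ∀ j < i, s.nat (16 + j) = bitCode (J j)) :
    (unused i).eval f M s ↔ ∀ j < i, s.nat 2 ∉ J j := by
  induction i with
  | zero => simp [unused, Test.eval]
  | succ i ih =>
    have h1 : (Test.bit (solCode i) (.var 3)).eval f M s ↔ s.nat 2 ∈ J i := by
      rw [Test.eval_bit (j := s.nat 2) (by simpa using hp), solCode, NatExpr.eval_var,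
        hJ i (by omega), testBit_bitCode]
    rw [unused, Test.eval, Test.eval, h1, ih fun j hj => hJ j (by omega)]
    simp only [Nat.lt_succ_iff_lt_or_eq, or_imp, forall_and, forall_eq]

omit [DecidableEq N] in
theorem eval_replaceable {s : State N} (hp : s.nat 3 = 2 ^ s.nat 2) (h0 : s.nat 0 = k)
    {J : ℕ → Finset ℕ} (hJ : ∀ j < n, s.nat (16 + j) = bitCode (J j)) :
    (replaceable n).eval f M s ↔
      10 * (n : ℝ) * (k + 1) * s.real (s.nat 2) ≤ s.real 0 ∧ ∀ j < n, s.nat 2 ∉ J j := by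
  rw [replaceable, Test.eval, eval_unused hp n hJ]
  simp [Test.eval, RealExpr.eval, NatExpr.eval, h0]

omit [Fintype N] in
/-- Some cell can be overwritten. -/
theorem exists_replaceable (hn : 9 ≤ n) (hk : M.eRank = k) {s : State N}
    (hst : Stored n k H S ω pos s) (h : ExchangeInv f M n (10 * (n : ℝ) * (k + 1)) P H S A ω)
    {T : ℕ → Finset N} (hT : ∀ i, T i ⊆ S i) {w : ℝ} (hw : totalWeight n S ω ≤ w) :
    ∃ j, 8 ≤ j ∧ j < 22 * n * (k + 1) ∧ 10 * (n : ℝ) * (k + 1) * s.real j ≤ w ∧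
      ∀ i < n, j ∉ (T i).image pos := by
  by_contra! hcon
  have hq : 0 ≤ 10 * (n : ℝ) * (k + 1) := by positivity
  have hw0 := h.totalWeight_nonneg.trans hw
  set G := H.filter fun x => w < 10 * (n : ℝ) * (k + 1) * ω x with hG
  -- Otherwise each cell from `8` on holds a heavy element or a member of a solution. There are at
  -- most `20 * n * (k + 1)` of the former and `n * k` of the latter, too few for `22 * n * (k + 1)
  -- - 8` cells.
  have hsub : Ico 8 (22 * n * (k + 1)) ⊆
      G.image pos ∪ (range n).biUnion fun i => (T i).image pos := by
    intro j hj
    obtain ⟨hj8, hjK⟩ := mem_Ico.1 hj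
    rw [mem_union, mem_biUnion]
    by_cases hlt : 10 * (n : ℝ) * (k + 1) * s.real j ≤ w
    · obtain ⟨i, hi, hji⟩ := hcon j hj8 hjK hlt
      exact .inr ⟨i, mem_range.2 hi, hji⟩
    · rw [not_le] at hlt
      -- A cell of weight zero is never heavy because `w ≥ 0`; thus a heavy cell holds an element of
      -- `H`.
      obtain ⟨x, hx, rfl⟩ := hst.empty j hj8 (fun h0 => by rw [h0] at hlt; linarith)
      rw [hst.weight x hx] at hlt
      exact .inl (mem_image_of_mem _ (mem_filter.2 ⟨hx, hlt⟩))
  have h1 : (G.image pos).card ≤ 20 * n * (k + 1) := by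
    refine card_image_le.trans ?_
    have := h.card_heavy_le hq hw
    rw [← hG] at this
    have h2 : (G.card : ℝ) ≤ ((20 * n * (k + 1) : ℕ) : ℝ) := by push_cast; linarith
    exact_mod_cast h2
  have h2 : ((range n).biUnion fun i => (T i).image pos).card ≤ n * k := by
    refine (card_biUnion_le_card_mul _ _ k fun i _ => card_image_le.trans ?_).trans (by simp)
    have h3 := ((h.indep i).subset (by exact_mod_cast hT i)).encard_le_eRank
    rw [hk, Set.encard_coe_eq_coe_finsetCard] at h3
    exact_mod_cast h3
  have h4 := (card_le_card hsub).trans (card_union_le _ _)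
  rw [Nat.card_Ico] at h4
  have h5 : 22 * n * (k + 1) = 20 * n * (k + 1) + n * k + n * k + 2 * n := by ring
  omega

/-- The state represents the memory of the exchange algorithm after the arrival of `P`. -/
def Represents (f : Finset N → ℝ) (M : Matroid N) (n k : ℕ) (P : Finset N) (s : State N) : Prop :=
  ∃ (H : Finset N) (S A : ℕ → Finset N) (ω : N → ℝ) (pos : N → ℕ),
    ExchangeInv f M n (10 * (n : ℝ) * (k + 1)) P H S A ω ∧ Stored n k H S ω pos s

omit [Fintype N] in
/-- The new memory after cell `a` has been overwritten by the arriving element. -/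
theorem represents_commit (hf : IsSubmodular f) (hE : M.E = Set.univ) {s t : State N}
    (h : ExchangeInv f M n (10 * (n : ℝ) * (k + 1)) P H S A ω) (hst : Stored n k H S ω pos s)
    (hu : u ∉ P) {d : ℝ} (hd : 0 < d) {j : ℕ} (hj : j < n)
    (hdj : d = f (insert u (S j)) - f (S j)) {V : Finset N} (hV : IsSwap M (S j) ω u V)
    (hVd : 2 * ∑ v ∈ V, ω v ≤ d) (hp : ∀ i < n, ExchangeInv.Passed f M (S i) ω u d)
    {a : ℕ} (ha8 : 8 ≤ a) (haK : a < 22 * n * (k + 1))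
    (haw : 10 * (n : ℝ) * (k + 1) * s.real a ≤ totalWeight n S ω + (d - ∑ v ∈ V, ω v))
    (haj : a ∉ (S j \ V).image pos) (hai : ∀ i < n, i ≠ j → a ∉ (S i).image pos)
    (htelem : t.elem = Function.update s.elem a (some u)) (ht0 : t.nat 0 = s.nat 0)
    (htreal0 : t.real 0 = totalWeight n S ω + (d - ∑ v ∈ V, ω v)) (htreala : t.real a = d)
    (htreal : ∀ b, 8 ≤ b → b ≠ a → t.real b = s.real b)
    (htcode : t.nat (16 + j) = bitCode ((S j \ V).image pos) + 2 ^ a)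
    (htcode' : ∀ i, i ≠ j → t.nat (16 + i) = s.nat (16 + i)) :
    Represents f M n k (insert u P) t := by
  have huS : ∀ i, u ∉ S i := h.notMem_sol hu
  have huH : u ∉ H := fun hx => hu (h.held_subset hx)
  have hω : ∀ i, ∀ x ∈ S i, Function.update ω u d x = ω x := fun i x hx =>
    Function.update_of_ne (ne_of_mem_of_not_mem hx (huS i)) _ _
  have hVω : ∑ v ∈ V, Function.update ω u d v = ∑ v ∈ V, ω v :=
    sum_congr rfl fun v hv => hω j v (hV.subset hv)
  have htot : totalWeight n S (Function.update ω u d) = totalWeight n S ω :=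
    sum_congr rfl fun i _ => sum_congr rfl fun x hx => hω i x hx
  have hposne : ∀ x ∈ H, Function.update pos u a x = pos x := fun x hx =>
    Function.update_of_ne (ne_of_mem_of_not_mem hx huH) _ _
  have himage : ∀ i, ∀ T ⊆ S i, T.image (Function.update pos u a) = T.image pos :=
    fun i T hT => image_congr fun x hx => hposne x (h.sol_held i (hT hx))
  -- The occupant of cell `a`, if any, leaves the memory; it is light by `haw` and in no solution by
  -- `haj` and `hai`.
  refine ⟨insert u (H.filter fun x => pos x ≠ a), Function.update S j (insert u (S j \ V)),
    Function.update A j (insert u (A j)), Function.update ω u d, Function.update pos u a, ?_, ?_⟩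
  · refine (h.update_weight hu hd.le).accept hf hE hu hj (by simpa using hdj) (by simpa using hd)
      (hV.congr (hω j)) (by simpa [hVω] using hVd)
      (fun i hi => by simpa using (hp i hi).congr (hω i)) (filter_subset _ _) ?_ ?_ ?_
    · intro i hij x hx
      refine mem_filter.2 ⟨h.sol_held i hx, fun hxa => ?_⟩
      rcases lt_or_ge i n with hi | hi
      · exact hai i hi hij (mem_image.2 ⟨x, hx, hxa⟩)
      · have := h.sol_subset i hx
        simp [h.acc_empty i hi] at this
    · intro x hx
      exact mem_filter.2 ⟨h.sol_held j (mem_sdiff.1 hx).1, fun hxa =>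
        haj (mem_image.2 ⟨x, hx, hxa⟩)⟩
    · intro x hx hxa
      have hxa' : pos x = a := by simpa [hx] using hxa
      rw [hVω, htot, Function.update_self,
        Function.update_of_ne (ne_of_mem_of_not_mem hx huH), ← hst.weight x hx, hxa']
      exact haw
  · refine ⟨ht0.trans hst.rank, ?_, ?_, ?_, ?_, ?_, ?_, ?_⟩
    · intro x hx
      rcases mem_insert.1 hx with rfl | hx
      · simp [htelem]
      · obtain ⟨hxH, hxa⟩ := mem_filter.1 hx
        rw [hposne x hxH, htelem, Function.update_of_ne hxa]
        exact hst.elem x hxH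
    · intro x hx
      rcases mem_insert.1 hx with rfl | hx
      · simpa using ha8
      · rw [hposne x (mem_filter.1 hx).1]
        exact hst.pos_ge x (mem_filter.1 hx).1
    · intro x hx
      rcases mem_insert.1 hx with rfl | hx
      · simpa using haK
      · rw [hposne x (mem_filter.1 hx).1]
        exact hst.pos_lt x (mem_filter.1 hx).1
    · intro x hx
      rcases mem_insert.1 hx with rfl | hx
      · simpa using htreala
      · obtain ⟨hxH, hxa⟩ := mem_filter.1 hx
        rw [hposne x hxH, htreal _ (hst.pos_ge x hxH) hxa, hst.weight x hxH,
          Function.update_of_ne (ne_of_mem_of_not_mem hxH huH)]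
    · intro b hb hne
      by_cases hba : b = a
      · exact ⟨u, by simp, by simp [hba]⟩
      · rw [htreal b hb hba] at hne
        obtain ⟨x, hx, rfl⟩ := hst.empty b hb hne
        exact ⟨x, mem_insert_of_mem (mem_filter.2 ⟨hx, hba⟩), hposne x hx⟩
    · intro i hi
      rcases eq_or_ne i j with rfl | hij
      · rw [htcode, Function.update_self, image_insert, Function.update_self,
          himage i _ sdiff_subset, bitCode_insert haj]
      · rw [htcode' i hij, Function.update_of_ne hij, himage i _ Subset.rfl]
        exact hst.code i hi
    · rw [htreal0, ExchangeInv.totalWeight_swap hj (huS j) hV.subset]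
      · rw [htot, hVω, Function.update_self]

end Commit

/-! ### Processing an element and the pass over the stream -/

section Runs

variable {N : Type*} [Fintype N] [DecidableEq N] {f : Finset N → ℝ} {M : Matroid N}
  {n k : ℕ} {P H : Finset N} {S A : ℕ → Finset N} {ω : N → ℝ} {pos : N → ℕ} {u : N}

theorem runs_commit (hf : IsSubmodular f) (hE : M.E = Set.univ) (hn : 9 ≤ n) (hk : M.eRank = k)
    {s : State N} (hs : Tame (16 + n) (22 * n * (k + 1)) s)
    (h : ExchangeInv f M n (10 * (n : ℝ) * (k + 1)) P H S A ω) (hst : Stored n k H S ω pos s)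
    (hu : s.elem 0 = some u) (huP : u ∉ P) (hsel : Selection f M S ω pos u n s)
    (h5 : s.nat 5 ≠ 0) :
    Runs f M (Tame (16 + n) (22 * n * (k + 1))) (commit n) s fun t =>
      Tame (16 + n) (22 * n * (k + 1)) t ∧ Represents f M n k (insert u P) t := by
  obtain ⟨j, hj, V, hj5, hd, hdj, hV, hV4, hVd, hV6⟩ := hsel.chosen.resolve_left fun h => h5 h.1
  have hK8 : 8 ≤ 22 * n * (k + 1) := by nlinarith
  set K := 22 * n * (k + 1) with hK
  set d := s.real 3 with hd3
  set w := totalWeight n S ω + (d - ∑ v ∈ V, ω v) with hw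
  have hVnn : 0 ≤ ∑ v ∈ V, ω v := sum_nonneg fun x _ => h.nonneg x
  have hww : totalWeight n S ω ≤ w := by linarith
  -- The solutions during the scan: `V` is already removed and `u` not yet inserted.
  set T := Function.update S j (S j \ V) with hT
  have hTS : ∀ i, T i ⊆ S i := fun i => by
    rcases eq_or_ne i j with rfl | hij
    · simp [hT]
    · simp [hT, hij]
  have hcodeT : ∀ i < n, bitCode ((T i).image pos) =
      if i = j then s.nat (16 + i) - s.nat 6 else s.nat (16 + i) := by
    intro i hi
    split_ifs with hij
    · subst hij
      rw [hst.code i hi, hV6, ← bitCode_sdiff (image_subset_image hV.subset), hT,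
        Function.update_self, image_sdiff_of_injOn (hst.injOn.mono
          (by exact_mod_cast h.sol_held i)) hV.subset]
    · rw [hst.code i hi, hT, Function.update_of_ne hij]
  -- The scan stops at `b` at the latest, so `b` minus the counter is the variant of the loop.
  obtain ⟨b, hb8, hbK, hbw, hbT⟩ := exists_replaceable hn hk hst h hTS hww
  refine .seq (.setReal hs 0 w rfl (by simp [RealExpr.eval, hst.total, hV4, hw, hd3]) (by omega) ?_)
  intro t1 ht1 he1 hn1 hr1
  refine .seq (.setNat ht1 (16 + j) (s.nat (16 + j) - s.nat 6) (by simp [hn1, hj5])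
    (by simp [NatExpr.eval, hn1, hj5]) (by omega) ((Nat.sub_le _ _).trans_lt (hs.lt _)) ?_)
  intro t2 ht2 he2 hr2 hn2
  refine .seq (runs_startAt ht2 8 (by omega) hK8 ?_)
  intro t3 ht3 he3 hr3 hj3 hp3 hn3
  have hcode3 : ∀ i < n, t3.nat (16 + i) = bitCode ((T i).image pos) := by
    intro i hi
    rw [hn3 _ (by omega) (by omega), hn2, hn1, hcodeT i hi, Function.update_apply]
    by_cases hij : i = j
    · simp [hij]
    · simp [hij]
  have hnat3 : ∀ a < 16, a ≠ 2 → a ≠ 3 → t3.nat a = s.nat a := fun a ha h2 h3 => by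
    rw [hn3 a h2 h3, hn2, Function.update_of_ne (by omega), hn1]
  have hreal3 : t3.real = Function.update s.real 0 w := by rw [hr3, hr2, hr1]
  have hrb : ∀ a, 8 ≤ a → t3.real a = s.real a := fun a ha => by
    rw [hreal3, Function.update_of_ne (by omega)]
  have hrep : ∀ r : State N, r.real = t3.real → (∀ a, a ≠ 2 → a ≠ 3 → r.nat a = t3.nat a) →
      r.nat 3 = 2 ^ r.nat 2 → 8 ≤ r.nat 2 → ((replaceable n).eval f M r ↔
        10 * (n : ℝ) * (k + 1) * s.real (r.nat 2) ≤ w ∧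
          ∀ i < n, r.nat 2 ∉ (T i).image pos) := by
    intro r hr hnr hpr h8
    rw [eval_replaceable (k := k) hpr (J := fun i => (T i).image pos), hr, hrb _ h8, hreal3,
      Function.update_self]
    · rw [hnr 0 (by simp) (by simp), hnat3 0 (by simp) (by simp) (by simp), hst.rank]
    · intro i hi
      rw [hnr _ (by omega) (by omega), hcode3 i hi]
  refine .seq_of (Q' := fun r => Tame (16 + n) K r ∧ r.elem = t3.elem ∧ r.real = t3.real ∧
      (∀ a, a ≠ 2 → a ≠ 3 → r.nat a = t3.nat a) ∧ 8 ≤ r.nat 2 ∧ r.nat 2 ≤ b ∧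
      r.nat 3 = 2 ^ r.nat 2 ∧ 10 * (n : ℝ) * (k + 1) * s.real (r.nat 2) ≤ w ∧
      ∀ i < n, r.nat 2 ∉ (T i).image pos)
    (Runs.loop (fun r => Tame (16 + n) K r ∧ r.elem = t3.elem ∧ r.real = t3.real ∧
      (∀ a, a ≠ 2 → a ≠ 3 → r.nat a = t3.nat a) ∧ 8 ≤ r.nat 2 ∧ r.nat 2 ≤ b ∧
      r.nat 3 = 2 ^ r.nat 2) (fun r => b - r.nat 2) (fun r hr => hr.1) ?_ ?_ ?_) ?_
  · rintro r ⟨hr1, hr2, hr3, hr4, hr5, hr6, hr7⟩ hb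
    rw [Test.eval, not_not, hrep r hr3 hr4 hr7 hr5] at hb
    exact ⟨hr1, hr2, hr3, hr4, hr5, hr6, hr7, hb⟩
  · rintro r ⟨hr1, hr2, hr3, hr4, hr5, hr6, hr7⟩ hb
    rw [Test.eval, hrep r hr3 hr4 hr7 hr5] at hb
    have hne : r.nat 2 ≠ b := fun e => hb (by rw [e]; exact ⟨hbw, hbT⟩)
    refine runs_advance hr1 (by omega) rfl hr7 (by omega) ?_
    intro q hq1 hq2 hq3 hq4 hq5 hq6
    exact ⟨⟨hq1, hq2.trans hr2, hq3.trans hr3, fun a h2 h3 => (hq6 a h2 h3).trans (hr4 a h2 h3),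
      by omega, by omega, by rw [hq5, hq4]⟩, by omega⟩
  · exact ⟨ht3, rfl, rfl, fun _ _ _ => rfl, hj3.ge, by omega, by rw [hp3, hj3]⟩
  rintro t4 ⟨ht4, he4, hr4, hn4, h84, hb4, hp4, hw4, hT4⟩
  set a := t4.nat 2 with ha
  have ht45 : t4.nat 5 = 16 + j := by
    rw [hn4 5 (by simp) (by simp), hnat3 5 (by simp) (by simp) (by simp), hj5]
  have hTj : (T j).image pos = (S j \ V).image pos := by rw [hT, Function.update_self]
  have hcode4 : t4.nat (16 + j) = bitCode ((S j \ V).image pos) := by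
    rw [hn4 _ (by omega) (by omega), hcode3 j hj, hTj]
  have hlt : bitCode ((S j \ V).image pos) + 2 ^ a < 2 ^ (K + 1) := by
    rw [← bitCode_insert (hTj ▸ hT4 j hj)]
    refine bitCode_lt fun i hi => ?_
    rcases mem_insert.1 hi with rfl | hi
    · omega
    · obtain ⟨x, hx, rfl⟩ := mem_image.1 hi
      have := hst.pos_lt x (h.sol_held j (mem_sdiff.1 hx).1)
      omega
  refine .seq (.copyElem ht4 a 0 rfl rfl (by omega) ?_)
  intro t5 ht5 hn5 hr5 he5
  refine .seq (.setReal ht5 a d (by simp [hn5, ha]) ?_ (by omega) ?_)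
  · rw [RealExpr.eval_var, hr5, hr4, hreal3, Function.update_of_ne (by simp)]
  intro t6 ht6 he6 hn6 hr6
  refine .setNat ht6 (16 + j) (bitCode ((S j \ V).image pos) + 2 ^ a) (by simp [hn6, hn5, ht45])
    (by simp [NatExpr.eval, hn6, hn5, ht45, hcode4, hp4]) (by omega) hlt ?_
  intro t7 ht7 he7 hr7 hn7
  refine ⟨ht7, represents_commit hf hE h hst huP hd hj hdj hV hVd hsel.passed h84 (by omega) hw4
    (hTj ▸ hT4 j hj) (fun i hi hij => ?_) ?_ ?_ ?_ ?_ ?_ ?_ ?_⟩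
  · have := hT4 i hi
    rwa [hT, Function.update_of_ne hij] at this
  · rw [he7, he6, he5, he4, he3, he2, he1, hu]
  · rw [hn7, Function.update_of_ne (by omega), hn6, hn5, hn4 0 (by simp) (by simp),
      hnat3 0 (by simp) (by simp) (by simp)]
  · rw [hr7, hr6, Function.update_of_ne (by omega), hr5, hr4, hreal3, Function.update_self]
  · rw [hr7, hr6, Function.update_self]
  · intro b hb hba
    rw [hr7, hr6, Function.update_of_ne hba, hr5, hr4, hrb b hb]
  · rw [hn7, Function.update_self]
  · intro i hij
    rw [hn7, Function.update_of_ne (by omega), hn6, hn5, hn4 _ (by omega) (by omega),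
      hn3 _ (by omega) (by omega), hn2, Function.update_of_ne (by omega), hn1]

omit [Fintype N] [DecidableEq N] in
theorem Tame.receive {c K : ℕ} {s : State N} (h : Tame c K s) (hK : 0 < K) (u : N) :
    Tame c K (s.receive u) :=
  ⟨fun j hj => (Function.update_of_ne (by omega) _ _).trans (h.elem j hj), h.real, h.nat, h.lt⟩

omit [Fintype N] [DecidableEq N] in
theorem Stored.receive {s : State N} (h : Stored n k H S ω pos s) (u : N) :
    Stored n k H S ω pos (s.receive u) := by
  refine ⟨h.rank, fun x hx => ?_, h.pos_ge, h.pos_lt, h.weight, h.empty, h.code, h.total⟩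
  have := h.pos_ge x hx
  exact (Function.update_of_ne (by omega) _ _).trans (h.elem x hx)

theorem runs_processElement (hf : IsSubmodular f) (hE : M.E = Set.univ) (hn : 9 ≤ n)
    (hk : M.eRank = k) {s : State N} (hs : Tame (16 + n) (22 * n * (k + 1)) s)
    (hP : Represents f M n k P s) (huP : u ∉ P) :
    Runs f M (Tame (16 + n) (22 * n * (k + 1))) (processElement n) (s.receive u) fun t =>
      Tame (16 + n) (22 * n * (k + 1)) t ∧ Represents f M n k (insert u P) t := by
  obtain ⟨H, S, A, ω, pos, h, hst⟩ := hP
  have hK8 : 8 ≤ 22 * n * (k + 1) := by nlinarith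
  refine .seq (.setNat (hs.receive (by omega) u) 5 0 rfl rfl (by omega) (by positivity) ?_)
  intro t1 ht1 he1 hr1 hn1
  refine .seq (.setReal ht1 3 0 rfl (by simp [RealExpr.eval]) (by omega) ?_)
  intro t2 ht2 he2 hn2 hr2
  have hsame : SameData (s.receive u) t2 := by
    refine ⟨by rw [he2, he1], ?_, fun i => ?_, ?_, fun j hj => ?_⟩
    · rw [hn2, hn1, Function.update_of_ne (by simp)]
    · rw [hn2, hn1, Function.update_of_ne (by omega)]
    · rw [hr2, Function.update_of_ne (by simp), hr1]
    · rw [hr2, Function.update_of_ne (by omega), hr1]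
  have hu : t2.elem 0 = some u := by simp [hsame.elem, State.receive]
  have hst2 := (hst.receive u).sameData hsame
  refine .seq_of (runs_examineAll (f := f) hE ht2 hst2 hu h.sol_held h.indep (h.notMem_sol huP)
    (by simp [hn2, hn1]) (by simp [hr2]) le_rfl) ?_
  rintro t3 ⟨ht3, hsame3, hsel⟩
  have hst3 := hst2.sameData hsame3
  refine .ite (fun hb => ?_) (fun hb => ?_)
  · simp only [Test.eval, NatExpr.eval_const, NatExpr.eval_var] at hb
    exact runs_commit hf hE hn hk ht3 h hst3 (by rw [hsame3.elem, hu]) huP hsel (by omega)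
  · simp only [Test.eval, NatExpr.eval_const, NatExpr.eval_var] at hb
    -- Without a chosen class the best gain is still `0`, so every class certifies the weight `0`
    -- for `u`.
    have h3 : t3.real 3 = 0 := by
      rcases hsel.chosen with h3 | ⟨j, -, V, h5, -⟩
      · exact h3.2
      · omega
    have huH : u ∉ H := fun hx => huP (h.held_subset hx)
    refine .skip ht3 ⟨ht3, H, S, A, Function.update ω u 0, pos,
      h.reject hf hE huP fun i hi => h3 ▸ hsel.passed i hi, hst3.rank, hst3.elem, hst3.pos_ge,
      hst3.pos_lt, fun x hx => ?_, hst3.empty, hst3.code, ?_⟩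
    · rw [hst3.weight x hx, Function.update_of_ne (ne_of_mem_of_not_mem hx huH)]
    · rw [hst3.total]
      exact sum_congr rfl fun i _ =>
        (ExchangeInv.sum_congr_update (h.notMem_sol huP i)).symm

theorem pass_processElement (hf : IsSubmodular f) (hE : M.E = Set.univ) (hn : 9 ≤ n)
    (hk : M.eRank = k) {W : State N → Prop}
    (hW : ∀ s, Tame (16 + n) (22 * n * (k + 1)) s → W s) (stream : List N) :
    ∀ (P : Finset N) (s : State N), Tame (16 + n) (22 * n * (k + 1)) s →
      Represents f M n k P s → stream.Nodup → (∀ x ∈ stream, x ∉ P) →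
      ∃ t, Pass f M W (processElement n) stream s t ∧ Tame (16 + n) (22 * n * (k + 1)) t ∧
        Represents f M n k (P ∪ stream.toFinset) t := by
  induction stream with
  | nil => exact fun P s hs hP _ _ => ⟨s, rfl, hs, by simpa using hP⟩
  | cons x l ih =>
    intro P s hs hP hnd hdisj
    obtain ⟨r, hr, hr1, hr2⟩ := runs_processElement hf hE hn hk hs hP (hdisj x (by simp))
    have ⟨hxl, hl⟩ := List.nodup_cons.1 hnd
    obtain ⟨t, ht, ht1, ht2⟩ := ih (insert x P) r hr1 hr2 hl (fun y hy => by
      rw [mem_insert, not_or]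
      exact ⟨fun e => hxl (e ▸ hy), hdisj y (by simp [hy])⟩)
    refine ⟨t, ⟨r, hr.mono hW, ht⟩, ht1, ?_⟩
    rwa [List.toFinset_cons, union_insert, ← insert_union]

end Runs

/-! ### Exhaustive search at the end and the output -/

section Output

variable {N : Type*} [Fintype N] [DecidableEq N] {f : Finset N → ℝ} {M : Matroid N}
  {n k c K : ℕ} {H : Finset N} {S : ℕ → Finset N} {ω : N → ℝ} {pos : N → ℕ}

omit [DecidableEq N] in
theorem runs_searchBest {s : State N} (hc : 8 ≤ c) (hK : 6 ≤ K) (hs : Tame c K s)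
    (h3 : s.nat 3 = 2 ^ K) (h7 : s.nat 7 = 0) (h4 : s.nat 4 = 0) (h5 : s.real 5 = f ∅) :
    Runs f M (Tame c K) searchBest s fun t => Tame c K t ∧ t.elem = s.elem ∧
      t.nat 0 = s.nat 0 ∧ M.Indep (s.pick (t.nat 4) : Set N) ∧
      ∀ m < 2 ^ K, M.Indep (s.pick m : Set N) → f (s.pick m) ≤ f (s.pick (t.nat 4)) := by
  -- The empty set is independent, so mask `0` is a valid initial record.
  have hp0 : s.pick 0 = ∅ := by
    ext x
    simp [State.mem_pick]
  refine Runs.loop (fun t => Tame c K t ∧ t.elem = s.elem ∧ t.nat 0 = s.nat 0 ∧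
      t.nat 3 = 2 ^ K ∧ M.Indep (s.pick (t.nat 4) : Set N) ∧ t.real 5 = f (s.pick (t.nat 4)) ∧
      t.nat 7 ≤ 2 ^ K ∧
      ∀ m < t.nat 7, M.Indep (s.pick m : Set N) → f (s.pick m) ≤ f (s.pick (t.nat 4)))
      (fun t => 2 ^ K - t.nat 7) (fun t h => h.1) ?_ ?_ ?_
  · rintro t ⟨ht, he, h0, hp, hi, -, -, hbest⟩ hb
    simp only [Test.eval, NatExpr.eval, NatExpr.eval_var, hp] at hb
    exact ⟨ht, he, h0, hi, fun m hm => hbest m (by omega)⟩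
  · rintro t ⟨ht, he, h0, hp, hi, hr, hle, hbest⟩ hb
    simp only [Test.eval, NatExpr.eval, NatExpr.eval_var, hp] at hb
    refine .seq_of (Q' := fun r => Tame c K r ∧ r.elem = s.elem ∧ r.nat 0 = s.nat 0 ∧
      r.nat 3 = 2 ^ K ∧ M.Indep (s.pick (r.nat 4) : Set N) ∧ r.real 5 = f (s.pick (r.nat 4)) ∧
      r.nat 7 = t.nat 7 ∧ ∀ m < t.nat 7 + 1,
        M.Indep (s.pick m : Set N) → f (s.pick m) ≤ f (s.pick (r.nat 4))) (.ite ?_ ?_) ?_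
    · rintro ⟨hb1, hb2⟩
      rw [Test.eval, NatExpr.eval_var, State.pick_congr he] at hb1
      rw [Test.eval, RealExpr.eval, NatExpr.eval_var, State.pick_congr he, RealExpr.eval_var,
        hr] at hb2
      refine .seq (.setReal ht 5 (f (s.pick (t.nat 7))) rfl ?_ (by omega) ?_)
      · rw [RealExpr.eval, NatExpr.eval_var, State.pick_congr he]
      intro r hr1 hr2 hr3 hr4
      refine .setNat hr1 4 (t.nat 7) rfl (by simp [hr3]) (by omega) (ht.lt 7) ?_
      intro q hq1 hq2 hq3 hq4
      have h4' : q.nat 4 = t.nat 7 := by simp [hq4]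
      have hne : ∀ a, a ≠ 4 → q.nat a = t.nat a := fun a ha => by
        rw [hq4, Function.update_of_ne ha, hr3]
      refine ⟨hq1, by rw [hq2, hr2, he], by rw [hne 0 (by simp), h0], by rw [hne 3 (by simp), hp],
        by rwa [h4'], by simp [h4', hq3, hr4], hne 7 (by simp), fun m hm hmi => ?_⟩
      rw [h4']
      rcases Nat.lt_succ_iff_lt_or_eq.1 hm with hm | rfl
      · exact (hbest m hm hmi).trans hb2
      · exact le_rfl
    · intro hb1
      refine .skip ht ⟨ht, he, h0, hp, hi, hr, rfl, fun m hm hmi => ?_⟩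
      rcases Nat.lt_succ_iff_lt_or_eq.1 hm with hm | rfl
      · exact hbest m hm hmi
      · by_contra hlt
        refine hb1 ⟨?_, ?_⟩
        · rwa [Test.eval, NatExpr.eval_var, State.pick_congr he]
        · rw [Test.eval, RealExpr.eval, NatExpr.eval_var, State.pick_congr he, RealExpr.eval_var,
            hr]
          exact (not_le.1 hlt).le
    · rintro r ⟨hr1, hr2, hr3, hr4, hr5, hr6, hr7, hr8⟩
      refine .setNat hr1 7 (t.nat 7 + 1) rfl (by simp [NatExpr.eval, hr7]) (by omega) ?_ ?_
      · rw [pow_succ]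
        omega
      intro q hq1 hq2 hq3 hq4
      have h7' : q.nat 7 = t.nat 7 + 1 := by simp [hq4]
      have hne : ∀ a, a ≠ 7 → q.nat a = r.nat a := fun a ha => by
        rw [hq4, Function.update_of_ne ha]
      rw [hne 4 (by simp), hne 0 (by simp), hne 3 (by simp), h7', hq3]
      exact ⟨⟨hq1, hq2.trans hr2, hr3, hr4, hr5, hr6, hb, hr8⟩, by omega⟩
  · refine ⟨hs, rfl, rfl, h3, ?_, ?_, by omega, ?_⟩
    · rw [h4, hp0]
      simp
    · rw [h4, hp0, h5]
    · rw [h7]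
      simp

omit [DecidableEq N] in
theorem runs_clearRest {s : State N} (hc : 8 ≤ c) (hs : Tame c (22 * n * (k + 1)) s)
    (h0 : s.nat 0 = k) (h2 : s.nat 2 = 0) (h3 : s.nat 3 = 2 ^ 0) :
    Runs f M (Tame c (22 * n * (k + 1))) (clearRest n) s fun t =>
      Tame c (22 * n * (k + 1)) t ∧ t.held = s.pick (s.nat 4) := by
  set K := 22 * n * (k + 1) with hK
  refine Runs.loop (fun t => Tame c K t ∧ t.nat 0 = k ∧ t.nat 3 = 2 ^ t.nat 2 ∧
      t.nat 4 = s.nat 4 ∧ ∀ a, t.elem a = if a < t.nat 2 ∧ (s.nat 4).testBit a = false then none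
        else s.elem a) (fun t => K - t.nat 2) (fun t h => h.1) ?_ ?_ ?_
  · rintro t ⟨ht, h0, hp, h4, he⟩ hb
    rw [Test.eval_inRange h0, ← hK, not_lt] at hb
    refine ⟨ht, ?_⟩
    ext x
    have hheld : x ∈ t.held ↔ ∃ a, t.elem a = some x := by
      classical simp [State.held]
    rw [hheld, State.mem_pick]
    refine exists_congr fun a => ?_
    rw [he a]
    split_ifs with ha
    · simp [ha.2]
    · constructor
      · intro hx
        refine ⟨?_, hx⟩
        by_contra hbit
        rw [Bool.not_eq_true] at hbit
        -- A surviving cell outside the mask would lie beyond the scanned range, where memory is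
        -- empty.
        have haK : K ≤ a := by
          by_contra hlt
          exact ha ⟨by omega, hbit⟩
        rw [hs.elem a haK] at hx
        cases hx
      · exact fun hx => hx.2
  · rintro t ⟨ht, h0, hp, h4, he⟩ hb
    rw [Test.eval_inRange h0, ← hK] at hb
    refine .seq_of (Q' := fun r => Tame c K r ∧ r.nat = t.nat ∧ ∀ a, r.elem a =
      if a < t.nat 2 + 1 ∧ (s.nat 4).testBit a = false then none else s.elem a) (.ite ?_ ?_) ?_
    · intro hbit
      rw [Test.eval_bit (j := t.nat 2) (by simpa using hp), NatExpr.eval_var, h4] at hbit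
      refine .skip ht ⟨ht, rfl, fun a => ?_⟩
      rw [he a]
      by_cases ha : a = t.nat 2
      · simp [ha, hbit]
      · have : a < t.nat 2 + 1 ↔ a < t.nat 2 := by omega
        simp only [this]
    · intro hbit
      rw [Test.eval_bit (j := t.nat 2) (by simpa using hp), NatExpr.eval_var, h4,
        Bool.not_eq_true] at hbit
      refine .clearElem ht (t.nat 2) rfl ?_
      intro r hr1 hr2 hr3 hr4
      refine ⟨hr1, hr2, fun a => ?_⟩
      rw [hr4]
      by_cases ha : a = t.nat 2
      · simp [ha, hbit]
      · have : a < t.nat 2 + 1 ↔ a < t.nat 2 := by omega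
        rw [Function.update_of_ne ha, he a]
        simp only [this]
    · rintro r ⟨hr1, hr2, hr3⟩
      refine runs_advance hr1 (by omega) (by rw [hr2]) (by rw [hr2, hp]) hb ?_
      intro q hq1 hq2 hq3 hq4 hq5 hq6
      refine ⟨⟨hq1, ?_, by rw [hq5, hq4], ?_, ?_⟩, by omega⟩
      · rw [hq6 0 (by simp) (by simp), hr2, h0]
      · rw [hq6 4 (by simp) (by simp), hr2, h4]
      · rw [hq2, hq4]
        exact hr3
  · refine ⟨hs, h0, by rw [h2, h3], rfl, fun a => ?_⟩
    simp [h2]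

omit [DecidableEq N] in
theorem runs_outputBest (hn : 1 ≤ n) {s : State N} (hs : Tame (16 + n) (22 * n * (k + 1)) s)
    (h0 : s.nat 0 = k) :
    Runs f M (Tame (16 + n) (22 * n * (k + 1))) (outputBest n) s fun t =>
      M.Indep (t.held : Set N) ∧ ∀ m < 2 ^ (22 * n * (k + 1)), M.Indep (s.pick m : Set N) →
        f (s.pick m) ≤ f t.held := by
  have hK8 : 8 ≤ 22 * n * (k + 1) := by nlinarith
  set K := 22 * n * (k + 1) with hK
  refine .seq (runs_startAt hs 0 (by omega) (by omega) ?_)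
  intro t1 ht1 he1 hr1 h21 h31 hn1
  refine .seq_of (Q' := fun t => Tame (16 + n) K t ∧ t.elem = s.elem ∧ t.nat 0 = k ∧
    t.nat 3 = 2 ^ K) (Runs.loop (fun t => Tame (16 + n) K t ∧ t.elem = s.elem ∧ t.nat 0 = k ∧
    t.nat 3 = 2 ^ t.nat 2 ∧ t.nat 2 ≤ K) (fun t => K - t.nat 2) (fun t ht => ht.1) ?_ ?_ ?_) ?_
  · rintro t ⟨ht, he, h0, hp, hle⟩ hb
    rw [Test.eval_inRange h0] at hb
    exact ⟨ht, he, h0, by rw [hp, show t.nat 2 = K by omega]⟩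
  · rintro t ⟨ht, he, h0, hp, hle⟩ hb
    rw [Test.eval_inRange h0] at hb
    refine runs_advance ht (by omega) rfl hp hb ?_
    intro q hq1 hq2 hq3 hq4 hq5 hq6
    exact ⟨⟨hq1, hq2.trans he, by rw [hq6 0 (by simp) (by simp), h0], by rw [hq5, hq4], by omega⟩,
      by omega⟩
  · exact ⟨ht1, he1, by rw [hn1 0 (by simp) (by simp), h0], by rw [h31, h21], by omega⟩
  rintro t2 ⟨ht2, he2, h02, h32⟩
  refine .seq (.setNat ht2 7 0 rfl rfl (by omega) (by positivity) ?_)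
  intro t3 ht3 he3 hr3 hn3
  refine .seq (.setNat ht3 4 0 rfl rfl (by omega) (by positivity) ?_)
  intro t4 ht4 he4 hr4 hn4
  refine .seq (.setReal ht4 5 (f ∅) rfl ?_ (by omega) ?_)
  · rw [RealExpr.eval]
    congr 1
    ext x
    simp [State.mem_pick]
  intro t5 ht5 he5 hn5 hr5
  have he : t5.elem = s.elem := by rw [he5, he4, he3, he2]
  refine .seq_of (runs_searchBest (by omega) (by omega) ht5 (by simp [hn5, hn4, hn3, h32])
    (by simp [hn5, hn4, hn3]) (by simp [hn5, hn4]) (by simp [hr5])) ?_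
  rintro t6 ⟨ht6, he6, h06, hind, hbest⟩
  refine .seq (runs_startAt ht6 0 (by omega) (by omega) ?_)
  intro t7 ht7 he7 hr7 h27 h37 hn7
  refine (runs_clearRest (by omega) ht7 ?_ h27 h37).mono ?_
  · rw [hn7 0 (by simp) (by simp), h06, hn5, hn4, Function.update_of_ne (by simp), hn3,
      Function.update_of_ne (by simp), h02]
  rintro t8 ⟨-, hheld⟩
  rw [hn7 4 (by simp) (by simp), State.pick_congr (s := t5) (by rw [he7, he6])] at hheld
  rw [hheld]
  refine ⟨hind, fun m hm => ?_⟩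
  rw [← State.pick_congr he]
  exact hbest m hm

theorem exchangeAlgorithm_outputs (hf : IsSubmodular f) (hf0 : ∀ S, 0 ≤ f S)
    (hE : M.E = Set.univ) (hn : 9 ≤ n) (hk : M.eRank = k) {W : State N → Prop}
    (hW : ∀ s, Tame (16 + n) (22 * n * (k + 1)) s → W s) {stream : List N} (hnd : stream.Nodup)
    (hmem : ∀ x, x ∈ stream) :
    ∃ R : Finset N, (exchangeAlgorithm n).Outputs f M W k stream R ∧ M.Indep (R : Set N) ∧
      ∀ O : Finset N, M.Indep (O : Set N) → ((n : ℝ) - 1) * f O ≤ 5.1 * n * f R := by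
  have hK : k + 1 ≤ 22 * n * (k + 1) := Nat.le_mul_of_pos_left _ (by omega)
  have hstart : Tame (16 + n) (22 * n * (k + 1)) (State.start N k) := by
    refine ⟨fun _ _ => rfl, fun _ _ => rfl, fun j hj => if_neg (by omega), fun j => ?_⟩
    simp only [State.start]
    split_ifs
    · exact (show k < 22 * n * (k + 1) + 1 by omega).trans Nat.lt_two_pow_self
    · positivity
  have hrep : Represents f M n k ∅ (State.start N k) :=
    ⟨∅, fun _ => ∅, fun _ => ∅, fun _ => 0, fun _ => 0, .init, by
      constructor <;> simp [State.start, bitCode, totalWeight]⟩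
  obtain ⟨s, hpass, hs, H, S, A, ω, pos, h, hst⟩ := pass_processElement hf hE hn hk hW stream ∅ _
    hstart hrep hnd (by simp)
  have huniv : ∅ ∪ stream.toFinset = univ := by
    ext x
    simp [hmem]
  rw [huniv] at h
  obtain ⟨t, ht, hind, hbest⟩ := runs_outputBest (f := f) (M := M) (by omega) hs hst.rank
  refine ⟨t.held, ⟨_, s, t, .skip (hW _ hstart), hpass, ht.mono hW, rfl⟩, hind, fun O hO => ?_⟩
  -- Every subset of `H` is the set picked by some mask below `2 ^ K`, so the search has considered
  -- it.
  refine h.guarantee hf hf0 (k := k) (by nlinarith) (by positivity) hk (fun T hT hTi => ?_) hO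
  have hpick : s.pick (bitCode (T.image pos)) = T :=
    State.pick_image fun x hx => hst.elem x (hT hx)
  have := hbest (bitCode (T.image pos)) (bitCode_lt fun j hj => by
    obtain ⟨x, hx, rfl⟩ := mem_image.1 hj
    exact hst.pos_lt x (hT hx))
  rw [hpick] at this
  exact this hTi

end Output

end StreamMachine

end

/-! ### The main theorem -/

theorem mainTheorem6 :
    ∃ (A : StreamMachine.Algorithm) (C : ℕ),
      ∀ (N : Type*) [Fintype N] [DecidableEq N] (f : Finset N → ℝ) (M : Matroid N) (k : ℕ)
        (stream : List N),
        (∀ S, 0 ≤ f S) → IsSubmodular f → M.E = Set.univ → M.eRank = k →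
        stream.Nodup → (∀ x, x ∈ stream) →
        ∃ R : Finset N,
          A.Outputs f M
            (StreamMachine.State.Fits (C * (k + 1)) (C * (k + 1) * Nat.log 2 (k + 2) ^ C))
            k stream R ∧
          M.Indep (R : Set N) ∧
          ∀ S : Finset N, M.Indep (S : Set N) → 0.1921 * f S ≤ f R := by
  -- Only a lower bound on `C` is kept, so the power with exponent `C` is never evaluated. The bound
  -- covers the bits: `116 * (2200 * (k + 1) + 1) ≤ 300000 * (k + 1)`.
  obtain ⟨C, hC⟩ : ∃ C : ℕ, 300000 ≤ C := ⟨300000, le_rfl⟩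
  -- With `100` classes the ratio is `99 / 510 > 0.194`.
  refine ⟨StreamMachine.exchangeAlgorithm 100, C, ?_⟩
  intro N _ _ f M k stream hf0 hf hE hk hnd hmem
  have hCk : 300000 * (k + 1) ≤ C * (k + 1) := Nat.mul_le_mul_right _ hC
  -- The logarithm of `k + 2` is at least one, so the polylogarithmic factor is not needed: `O(k)`
  -- bits suffice.
  have hB : C * (k + 1) ≤ C * (k + 1) * Nat.log 2 (k + 2) ^ C :=
    Nat.le_mul_of_pos_right _ (Nat.pow_pos (Nat.log_pos (by norm_num) (by omega)))
  have hcells : 22 * 100 * (k + 1) ≤ 300000 * (k + 1) := Nat.mul_le_mul_right _ (by norm_num)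
  have hbits : (16 + 100) * (22 * 100 * (k + 1) + 1) ≤ 300000 * (k + 1) := by
    ring_nf
    gcongr <;> norm_num
  obtain ⟨R, hR, hind, hopt⟩ := StreamMachine.exchangeAlgorithm_outputs (n := 100) hf hf0 hE
    (by norm_num) hk (W := StreamMachine.State.Fits (C * (k + 1))
      (C * (k + 1) * Nat.log 2 (k + 2) ^ C))
    (fun s hs => hs.fits (hcells.trans hCk) ((hcells.trans hCk).trans hB)
      ((hbits.trans hCk).trans hB)) hnd hmem
  refine ⟨R, hR, hind, fun S hS => ?_⟩
  have h1 := hopt S hS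
  have h2 := hf0 S
  norm_num at h1 ⊢
  linarith
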